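/- Let $T\subset\mathbb{R}^2$ be the triangle with vertices $(0,0)$, $(1,0)$, $(0,1)$. For $n\ge 0$ let $\mathbf X_1,\dots,\mathbf X_n$ be independent random points, uniformly distributed in $T$, and let $T_n$ be the convex hull of $(1,0)$, $(0,1)$, $\mathbf X_1,\dots,\mathbf X_n$. Write $f_0(T_n)$ for the number of vertices of $T_n$, and for $k\in\{0,\dots,n\}$ put $$p_k^{(n)}:=\mathbb{P}\big(f_0(T_n)=k+2\big).$$ **Theorem 8 (Probability asymptotic for fixed $k$).** Let $k\ge 0$ be a fixed integer. Then, as $n\to\infty$, $$p_{k+1}^{(n)}=\frac{2^{k+1}}{k!}\,\frac{(\log n)^k}{n}\,\Big(1+O\Big(\frac1{\log n}\Big)\Big)$$ and $$p_{n-k}^{(n)}=\frac{n^{3k-1}}{3^k\,k!}\,\frac{2^n}{(n!)^2}\,\Big(1+O\Big(\frac1n\Big)\Big),$$ where the constants implied in $O(\cdot)$ may depend on $k$. Moreover, there is a polynomial $C_k$ with real coefficients, of degree exactly $3k$, such that $$p_{n-k}^{(n)}\cdot\frac{n!\,(n+1)!}{2^n}=C_k(n)\qquad\text{for all integers } n\ge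 k.$$ -/

import Mathlib

open MeasureTheory Asymptotics

namespace RandomConvexChain

/-- The closed triangle `T` with vertices `(0,0)`, `(1,0)` and `(0,1)`. -/
def triangle : Set (ℝ × ℝ) :=
  convexHull ℝ {((0 : ℝ), (0 : ℝ)), (1, 0), (0, 1)}

/-- The uniform distribution on `T`: Lebesgue measure on `T`, divided by the area of `T`. -/
noncomputable def uniformTriangle : Measure (ℝ × ℝ) :=
  ProbabilityTheory.cond volume triangle

/-- The joint law of `n` independent uniformly distributed random points in `T`. -/
noncomputable def pointsLaw (n : ℕ) : Measure (Fin n → ℝ × ℝ) :=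
  Measure.pi fun _ => uniformTriangle

/-- `T_n`, the convex hull of `(1,0)`, `(0,1)` and the points `x 0, …, x (n - 1)`. -/
def chainHull {n : ℕ} (x : Fin n → ℝ × ℝ) : Set (ℝ × ℝ) :=
  convexHull ℝ ({((1 : ℝ), (0 : ℝ)), (0, 1)} ∪ Set.range x)

/-- `f₀(T_n)`, the number of vertices (extreme points) of the polygon `T_n`. -/
noncomputable def numVertices {n : ℕ} (x : Fin n → ℝ × ℝ) : ℕ :=
  (Set.extremePoints ℝ (chainHull x)).ncard

/-- `prob n k` is the probability that `f₀(T_n) = k + 2`. -/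
noncomputable def prob (n k : ℕ) : ℝ :=
  (pointsLaw n).real {x | numVertices x = k + 2}

end RandomConvexChain

namespace RandomConvexChain

/-! Almost surely the points are distinct and interior to `T`, so `numVertices` is `chainCount + 2`
and the problem concerns the convex chain from `(1, 0)` to `(0, 1)`. Let `v` be the first vertex of
the chain after `(1, 0)`: the point minimizing the slope `q = v.2 / (1 - v.1)`. All other points lie
beyond the line through `(1, 0)` and `v`, and the chord from `v` to `(0, 1)` cuts what remains of
`T` into two triangles. Points in the triangle `(1, 0)`, `v`, `(0, 1)` are hidden and never become
vertices. The other triangle is an affine image of `T` carrying `(1, 0)` to `v` and fixing `(0, 1)`,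
so the points in it form an independent copy of the same problem (`chainCount_eq_split`,
`pi_cornerRegion_chainCount`).

Given `v`, the two triangles have probabilities `v.1 * (1 - q)` and `(1 - v.1) * (1 - q)`. Summing
over the choice of the first vertex and over the number `m` of points in the second triangle, then
integrating over `v` with a Beta integral, gives the recursion `prob_succ_succ`: $p^{(n+1)}_{k+1} =
\frac{2}{(n+1)(n+2)} \sum_{m \le n} (n+1-m)\, p^{(m)}_k$. Everything else follows from it and the
initial values.

Near the top, `scaledProb` turns the recursion into a first-order difference equation whose
right-hand side involves only smaller `k`. Its dominant term raises the degree by two, and summation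
by one more, dividing by the new degree $3k$; hence polynomials of degree $3k$ with leading
coefficient $1/(3^k k!)$ (`exists_polynomial_scaledProb`).

For few vertices, `weightedProb` satisfies approximately $w_{k+1}(n) = 2\sum_{m<n} w_k(m)/(m+2)$
with $w_0 = 2$. Summation against $1/m$ acts on powers of the harmonic numbers like integration, so
$w_k(n) = \frac{2^{k+1}}{k!} H_n^k + O(H_n^{k-1})$ for $k \ge 1$ (`weightedProb_le`,
`exists_le_weightedProb`), and $H_n$ is within a constant of $\log n$. -/

/-- The interior of the triangle `T`. -/
def openTriangle : Set (ℝ × ℝ) := {p | 0 < p.1 ∧ 0 < p.2 ∧ p.1 + p.2 < 1}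

/-- The number of points of the family `y` that do not lie in the convex hull of `a`, `b` and the
other points of the family. -/
noncomputable def chainCount {ι : Type*} (a b : ℝ × ℝ) (y : ι → ℝ × ℝ) : ℕ :=
  {j | y j ∉ convexHull ℝ ({a, b} ∪ y '' {j}ᶜ)}.ncard

/-! ### Planar geometry: splitting a chain at its first vertex -/

/-- The affine function of `p` vanishing on the line through `(1, 0)` and `v`. -/
def raySide (v p : ℝ × ℝ) : ℝ := p.2 * (1 - v.1) - v.2 * (1 - p.1)

/-- The affine function of `p` vanishing on the line through `v` and `(0, 1)`. -/
def chordSide (v p : ℝ × ℝ) : ℝ := v.1 * (p.2 - 1) + (1 - v.2) * p.1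

theorem raySide_combo (v x y : ℝ × ℝ) {a b : ℝ} (h : a + b = 1) :
    raySide v (a • x + b • y) = a * raySide v x + b * raySide v y := by
  obtain rfl : b = 1 - a := by linarith
  simp [raySide]; ring

theorem chordSide_combo (v x y : ℝ × ℝ) {a b : ℝ} (h : a + b = 1) :
    chordSide v (a • x + b • y) = a * chordSide v x + b * chordSide v y := by
  obtain rfl : b = 1 - a := by linarith
  simp [chordSide]; ring

theorem convex_raySide_nonneg (v : ℝ × ℝ) : Convex ℝ {p | 0 ≤ raySide v p} := by
  intro x hx y hy a b ha hb hab
  simp only [Set.mem_ofPred_eq] at *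
  rw [raySide_combo v x y hab]; positivity

theorem convex_raySide_pos (v : ℝ × ℝ) : Convex ℝ {p | 0 < raySide v p} := by
  intro x hx y hy a b ha hb hab
  simp only [Set.mem_ofPred_eq] at *
  rw [raySide_combo v x y hab]
  rcases ha.eq_or_lt with rfl | ha
  · obtain rfl : b = 1 := by linarith
    simpa using hy
  · positivity

theorem convex_chordSide_nonpos (v : ℝ × ℝ) : Convex ℝ {p | chordSide v p ≤ 0} := by
  intro x hx y hy a b ha hb hab
  simp only [Set.mem_ofPred_eq] at *
  rw [chordSide_combo v x y hab]
  nlinarith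

theorem convex_fst_nonneg : Convex ℝ {p : ℝ × ℝ | 0 ≤ p.1} := by
  intro x hx y hy a b ha hb hab
  simp only [Set.mem_ofPred_eq] at *
  simp; positivity

/-- A point on the inner sides of the lines through `v` lies in the triangle with vertices
`(1, 0)`, `v`, `(0, 1)`. -/
theorem mem_convexHull_of_sides {v p : ℝ × ℝ} (hv : v.1 + v.2 < 1) (hp : p.1 + p.2 ≤ 1)
    (hr : 0 ≤ raySide v p) (hc : 0 ≤ chordSide v p) :
    p ∈ convexHull ℝ {((1 : ℝ), (0 : ℝ)), v, (0, 1)} := by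
  rw [convexHull_insert (by simp), convexHull_pair]
  have hd : 0 < 1 - v.1 - v.2 := by linarith
  set d := 1 - v.1 - v.2 with hd_def
  -- After division by `d` the three summands are the barycentric coordinates of `p` with respect to
  -- `(1, 0)`, `v` and `(0, 1)`.
  have hsum : chordSide v p + (1 - p.1 - p.2) + raySide v p = d := by
    simp only [chordSide, raySide, hd_def]; ring
  rcases (show 0 ≤ (1 - p.1 - p.2) + raySide v p by linarith).eq_or_lt with h0 | h0
  · have h1 : raySide v p = 0 := by linarith
    have h2 : p.1 + p.2 = 1 := by linarith
    have h3 : p.2 * d = 0 := by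
      have : p.1 = 1 - p.2 := by linarith
      simp only [raySide, this] at h1; simp only [hd_def]; linarith
    have h4 : p.2 = 0 := by
      rcases mul_eq_zero.1 h3 with h | h
      · exact h
      · exact absurd h hd.ne'
    have : p = (1, 0) := by ext <;> simp <;> linarith
    rw [this, mem_convexJoin]
    exact ⟨(1, 0), rfl, v, left_mem_segment _ _ _, left_mem_segment _ _ _⟩
  · set e := (1 - p.1 - p.2) + raySide v p with he
    rw [mem_convexJoin]
    refine ⟨(1, 0), rfl, ((1 - p.1 - p.2) / e) • v + (raySide v p / e) • ((0 : ℝ), (1 : ℝ)),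
      ⟨_, _, div_nonneg (by linarith) h0.le, div_nonneg hr h0.le, ?_, rfl⟩,
      ⟨chordSide v p / d, e / d, div_nonneg hc hd.le, div_nonneg h0.le hd.le, ?_, ?_⟩⟩
    · rw [← add_div, div_self h0.ne']
    · rw [← add_div, div_eq_one_iff_eq hd.ne']; linarith
    · ext
      · simp; field_simp
        simp only [chordSide, hd_def]; ring
      · simp; field_simp
        simp only [raySide, hd_def]; ring

/-- Cutting the convex hull of `(1, 0)` and `W` along the chord from `v` to `(0, 1)`. -/
theorem mem_convexHull_of_insert {v p : ℝ × ℝ} {W : Set (ℝ × ℝ)} (hv0 : 0 < v.1)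
    (hv : v.1 + v.2 < 1) (hvW : v ∈ W) (hBW : ((0 : ℝ), (1 : ℝ)) ∈ W)
    (hW : ∀ w ∈ W, chordSide v w ≤ 0 ∧ 0 ≤ raySide v w ∧ 0 ≤ w.1)
    (hp : p ∈ convexHull ℝ (insert ((1 : ℝ), (0 : ℝ)) W)) (hpc : chordSide v p ≤ 0) :
    p ∈ convexHull ℝ W := by
  rw [convexHull_insert ⟨v, hvW⟩, mem_convexJoin] at hp
  obtain ⟨a, rfl, w, hw, s, t, hs, ht, hst, rfl⟩ := hp
  have hwc : chordSide v w ≤ 0 :=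
    convexHull_min (fun w hw => (hW w hw).1) (convex_chordSide_nonpos v) hw
  have hwr : 0 ≤ raySide v w :=
    convexHull_min (fun w hw => (hW w hw).2.1) (convex_raySide_nonneg v) hw
  have hw1 : 0 ≤ w.1 := convexHull_min (fun w hw => (hW w hw).2.2) convex_fst_nonneg hw
  rw [chordSide_combo v _ _ hst] at hpc
  have hA : chordSide v (1, 0) = 1 - v.1 - v.2 := by simp [chordSide]; ring
  have hAr : raySide v (1, 0) = 0 := by simp [raySide]
  have hA0 : 0 < chordSide v (1, 0) := by rw [hA]; linarith
  set α := chordSide v (1, 0) with hα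
  have hD : 0 < α - chordSide v w := by linarith
  set β := chordSide v w with hβ
  -- `c` is where the segment from `(1, 0)` to `w` meets the line through `v` and `(0, 1)`. The
  -- signs of `raySide v c` and `c.1` place it between these two points, hence in the hull of `W`,
  -- and `p` lies on the segment from `c` to `w`.
  set c : ℝ × ℝ := (-β / (α - β)) • ((1 : ℝ), (0 : ℝ)) + (α / (α - β)) • w with hc
  have hsum : -β / (α - β) + α / (α - β) = 1 := by field_simp; ring
  have hn1 : 0 ≤ -β / (α - β) := div_nonneg (by linarith) hD.le
  have hn2 : 0 ≤ α / (α - β) := div_nonneg hA0.le hD.le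
  have hc0 : chordSide v c = 0 := by
    rw [hc, chordSide_combo v _ _ hsum, ← hα, ← hβ]; field_simp; ring
  have hcr : 0 ≤ raySide v c := by
    rw [hc, raySide_combo v _ _ hsum, hAr]; positivity
  have hc1 : 0 ≤ c.1 := by
    simp [hc]; positivity
  have hcW : c ∈ convexHull ℝ W := by
    have hseg : c ∈ segment ℝ v ((0 : ℝ), (1 : ℝ)) := by
      have e2 : v.1 * c.2 = v.1 - (1 - v.2) * c.1 := by
        simp only [chordSide] at hc0; linarith
      have hle : c.1 ≤ v.1 := by
        have h5 : 0 ≤ v.1 * raySide v c := mul_nonneg hv0.le hcr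
        have h6 : v.1 * raySide v c = (1 - v.1 - v.2) * (v.1 - c.1) := by
          simp only [raySide]
          linear_combination (1 - v.1) * e2
        rw [h6] at h5
        have := nonneg_of_mul_nonneg_right h5 (by linarith)
        linarith
      refine ⟨c.1 / v.1, 1 - c.1 / v.1, by positivity, ?_, by ring, ?_⟩
      · rw [sub_nonneg, div_le_one hv0]; exact hle
      · ext
        · simp; field_simp
        · simp; field_simp; linarith
    exact (convex_convexHull ℝ W).segment_subset (subset_convexHull ℝ W hvW)
      (subset_convexHull ℝ W hBW) hseg
  have hts : s * α ≤ t * (-β) := by linarith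
  have hseg : s • ((1 : ℝ), (0 : ℝ)) + t • w ∈ segment ℝ c w := by
    rcases hwc.eq_or_lt with h0 | h0
    · have hs0 : s = 0 := by
        rw [h0] at hts
        nlinarith
      obtain rfl : t = 1 := by linarith
      rw [hs0]; simpa using right_mem_segment ℝ c w
    · refine ⟨s * (α - β) / -β, 1 - s * (α - β) / -β, div_nonneg (by positivity) (by linarith),
        ?_, by ring, ?_⟩
      · rw [sub_nonneg, div_le_one (by linarith)]
        have : t = 1 - s := by linarith
        rw [this] at hts; linarith
      · obtain rfl : t = 1 - s := by linarith
        have hβ0 : β ≠ 0 := h0.ne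
        have hD0 := hD.ne'
        rw [hc]
        ext
        · simp; field_simp; ring
        · simp; field_simp; ring
  exact (convex_convexHull ℝ W).segment_subset hcW hw hseg

/-- The point `x i` comes first in the angular order around `(1, 0)`, hence is a vertex: this is the
`+ 1`. Points on the inner side of the chord to `(0, 1)` lie in the triangle `(1, 0)`, `x i`, `(0,
1)`, so they are not counted and add nothing to the hull of the others. Cutting that hull along the
chord shows that, beyond it, only `x i`, `(0, 1)` and the points satisfying `p` matter. -/
theorem chainCount_eq_split {n : ℕ} {x : Fin (n + 1) → ℝ × ℝ} {i : Fin (n + 1)}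
    {p : Fin n → Prop} (hv : x i ∈ openTriangle)
    (hx : ∀ j, x (i.succAbove j) ∈ openTriangle)
    (hr : ∀ j, 0 < raySide (x i) (x (i.succAbove j)))
    (hp : ∀ j, p j ↔ chordSide (x i) (x (i.succAbove j)) < 0) :
    chainCount (1, 0) (0, 1) x =
      chainCount (x i) (0, 1) (fun j : Subtype p => x (i.succAbove j)) + 1 := by
  classical
  set v := x i with hvdef
  obtain ⟨hv1, hv2, hv3⟩ := hv
  have key : {j | x j ∉ convexHull ℝ ({((1 : ℝ), (0 : ℝ)), (0, 1)} ∪ x '' {j}ᶜ)} =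
      insert i ((fun j : Subtype p => i.succAbove j) ''
        {j : Subtype p | x (i.succAbove j) ∉ convexHull ℝ
          ({v, ((0 : ℝ), (1 : ℝ))} ∪ (fun j : Subtype p => x (i.succAbove j)) '' {j}ᶜ)}) := by
    ext m
    rcases eq_or_ne m i with rfl | hm
    · simp only [Set.mem_ofPred_eq, Set.mem_insert_iff, true_or, iff_true]
      intro h
      rw [Set.insert_union, convexHull_insert ⟨(0, 1), by simp⟩, mem_convexJoin] at h
      obtain ⟨a, rfl, w, hw, s, t, hs, ht, hst, hsw⟩ := h
      -- If `v` were on a segment from `(1, 0)` to such a `w`, then, `raySide v` vanishing at `v`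
      -- and `(1, 0)`, the weight of `w` would be zero and `v` would equal `(1, 0)`.
      have hw' : 0 < raySide v w := by
        refine convexHull_min ?_ (convex_raySide_pos v) hw
        rintro w (rfl | ⟨j, hj, rfl⟩)
        · simp [raySide]; linarith
        · obtain ⟨j, rfl⟩ := Fin.exists_succAbove_eq hj
          exact hr j
      have h0 := congrArg (raySide v) hsw
      rw [raySide_combo v _ _ hst] at h0
      have h1 : raySide v v = 0 := by simp [raySide]
      have h2 : raySide v (1, 0) = 0 := by simp [raySide]
      rw [← hvdef, h1, h2, mul_zero, zero_add] at h0
      have ht0 : t = 0 := by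
        rcases mul_eq_zero.1 h0 with h | h
        · exact h
        · exact absurd h hw'.ne'
      obtain rfl : s = 1 := by linarith
      have h3 := congrArg Prod.fst hsw
      simp [ht0] at h3
      rw [← hvdef] at h3
      linarith
    · obtain ⟨j, rfl⟩ := Fin.exists_succAbove_eq hm
      simp only [Set.mem_ofPred_eq, Set.mem_insert_iff, hm, false_or, Set.mem_image,
        Subtype.exists, exists_and_right]
      by_cases hpj : p j
      · have : (∃ a, (∃ (h : p a), x (i.succAbove a) ∉ convexHull ℝ
            ({v, ((0 : ℝ), (1 : ℝ))} ∪
              (fun j : Subtype p => x (i.succAbove j)) '' {⟨a, h⟩}ᶜ)) ∧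
            i.succAbove a = i.succAbove j) ↔
            x (i.succAbove j) ∉ convexHull ℝ ({v, ((0 : ℝ), (1 : ℝ))} ∪
              (fun j : Subtype p => x (i.succAbove j)) '' {⟨j, hpj⟩}ᶜ) := by
          constructor
          · rintro ⟨a, ⟨h, ha⟩, haj⟩
            obtain rfl := Fin.succAbove_right_injective haj
            exact ha
          · exact fun h => ⟨j, ⟨hpj, h⟩, rfl⟩
        rw [this, not_iff_not]
        constructor
        · intro h
          set W := ({v, ((0 : ℝ), (1 : ℝ))} ∪
            (fun j : Subtype p => x (i.succAbove j)) '' {⟨j, hpj⟩}ᶜ : Set (ℝ × ℝ)) with hW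
          -- Hidden points are absorbed into the triangle spanned by `(1, 0)`, `v` and `(0, 1)`.
          have hsub : convexHull ℝ ({((1 : ℝ), (0 : ℝ)), (0, 1)} ∪ x '' {i.succAbove j}ᶜ) ⊆
              convexHull ℝ (insert ((1 : ℝ), (0 : ℝ)) W) := by
            refine convexHull_min ?_ (convex_convexHull _ _)
            rintro w ((rfl | rfl) | ⟨m, hmj, rfl⟩)
            · exact subset_convexHull _ _ (by simp)
            · exact subset_convexHull _ _ (by simp [W])
            · rcases eq_or_ne m i with rfl | hmi
              · exact subset_convexHull _ _ (by simp [W, hvdef])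
              · obtain ⟨l, rfl⟩ := Fin.exists_succAbove_eq hmi
                by_cases hpl : p l
                · refine subset_convexHull _ _ (Or.inr (Or.inr ⟨⟨l, hpl⟩, ?_, rfl⟩))
                  simp only [Set.mem_compl_iff, Set.mem_singleton_iff, Subtype.mk.injEq]
                  rintro rfl
                  exact hmj rfl
                · have hl : 0 ≤ chordSide v (x (i.succAbove l)) :=
                    not_lt.1 (fun h => hpl ((hp l).2 h))
                  have h4 := mem_convexHull_of_sides hv3 (hx l).2.2.le (hr l).le hl
                  refine convexHull_mono ?_ h4
                  rintro w (rfl | rfl | rfl) <;> simp [W]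
          refine mem_convexHull_of_insert hv1 hv3 (by simp [W]) (by simp [W]) ?_ (hsub h)
            ((hp j).1 hpj).le
          rintro w ((rfl | rfl) | ⟨⟨l, hl⟩, -, rfl⟩)
          · refine ⟨?_, ?_, hv1.le⟩
            · simp only [chordSide]; linarith
            · simp only [raySide]; linarith
          · refine ⟨by simp [chordSide], by simp [raySide]; linarith, by simp⟩
          · exact ⟨((hp l).1 hl).le, (hr l).le, (hx l).1.le⟩
        · refine fun h => convexHull_mono ?_ h
          rintro w ((rfl | rfl) | ⟨⟨l, hl⟩, hlj, rfl⟩)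
          · exact Or.inr ⟨i, hm.symm, rfl⟩
          · exact Or.inl (by simp)
          · refine Or.inr ⟨i.succAbove l, ?_, rfl⟩
            intro h
            exact hlj (Subtype.ext (Fin.succAbove_right_injective h))
      · have h1 : ¬ ∃ a, (∃ (h : p a), x (i.succAbove a) ∉ convexHull ℝ
            ({v, ((0 : ℝ), (1 : ℝ))} ∪
              (fun j : Subtype p => x (i.succAbove j)) '' {⟨a, h⟩}ᶜ)) ∧
            i.succAbove a = i.succAbove j := by
          rintro ⟨a, ⟨h, -⟩, haj⟩
          obtain rfl := Fin.succAbove_right_injective haj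
          exact hpj h
        simp only [h1, iff_false, not_not]
        have hl : 0 ≤ chordSide v (x (i.succAbove j)) :=
          not_lt.1 (fun h => hpj ((hp j).2 h))
        refine convexHull_mono ?_ (mem_convexHull_of_sides hv3 (hx j).2.2.le (hr j).le hl)
        rintro w (rfl | rfl | rfl)
        · exact Or.inl (by simp)
        · exact Or.inr ⟨i, hm.symm, rfl⟩
        · exact Or.inl (by simp)
  unfold chainCount
  rw [key, Set.ncard_insert_of_notMem, Set.ncard_image_of_injective]
  · exact fun a b h => Subtype.ext (Fin.succAbove_right_injective h)
  · rintro ⟨j, -, hj⟩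
    exact Fin.succAbove_ne _ _ hj

/-- Affine invariance is what makes the chain beyond the chord a copy of the original one. -/
theorem chainCount_map {ι : Type*} (f : ℝ × ℝ →ᵃ[ℝ] ℝ × ℝ) (hf : Function.Injective f)
    (a b : ℝ × ℝ) (y : ι → ℝ × ℝ) :
    chainCount (f a) (f b) (fun j => f (y j)) = chainCount a b y := by
  unfold chainCount
  congr 1
  ext j
  have : ({f a, f b} ∪ (fun j => f (y j)) '' {j}ᶜ : Set (ℝ × ℝ)) =
      f '' ({a, b} ∪ y '' {j}ᶜ) := by
    rw [Set.image_union, Set.image_pair, Set.image_image]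
  simp only [Set.mem_ofPred_eq]
  rw [this, ← AffineMap.image_convexHull, hf.mem_set_image]

theorem chainCount_comp_equiv {ι κ : Type*} (e : ι ≃ κ) (a b : ℝ × ℝ) (y : κ → ℝ × ℝ) :
    chainCount a b (y ∘ e) = chainCount a b y := by
  unfold chainCount
  have : {j | (y ∘ e) j ∉ convexHull ℝ ({a, b} ∪ (y ∘ e) '' {j}ᶜ)} =
      e.symm '' {j | y j ∉ convexHull ℝ ({a, b} ∪ y '' {j}ᶜ)} := by
    rw [Equiv.image_symm_eq_preimage]
    ext j
    rw [Set.mem_preimage, Set.mem_ofPred_eq, Set.mem_ofPred_eq, Set.image_comp,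
      Set.image_compl_eq e.bijective, Set.image_singleton]
    rfl
  rw [this, Set.ncard_image_of_injective _ e.symm.injective]

/-! ### Vertices of the polygon as a chain count -/

/-- If `x` is inside a segment with endpoints in the hull, each endpoint is a mixture of `x` and a
point of the hull of `s \ {x}`. Cancelling the share of `x` writes `x` as a convex combination of
those two points, unless their total weight is zero. -/
theorem mem_extremePoints_convexHull_iff {E : Type*} [AddCommGroup E] [Module ℝ E] {s : Set E}
    {x : E} : x ∈ (convexHull ℝ s).extremePoints ℝ ↔ x ∈ s ∧ x ∉ convexHull ℝ (s \ {x}) := by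
  constructor
  · intro h
    refine ⟨extremePoints_convexHull_subset h, fun hx => ?_⟩
    rw [(convex_convexHull ℝ s).mem_extremePoints_iff_mem_sdiff_convexHull_sdiff] at h
    exact h.2 (convexHull_mono (Set.sdiff_subset_sdiff_left (subset_convexHull ℝ s)) hx)
  · rintro ⟨hxs, hx⟩
    refine ⟨subset_convexHull ℝ s hxs, ?_⟩
    intro x₁ h₁ x₂ h₂ hseg
    have hs : s = insert x (s \ {x}) := by simp [Set.insert_eq_of_mem hxs]
    rcases (s \ {x}).eq_empty_or_nonempty with he | hne
    · rw [hs, he] at h₁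
      simpa using h₁
    · rw [hs, convexHull_insert hne] at h₁ h₂
      simp only [mem_convexJoin, Set.mem_singleton_iff, exists_eq_left] at h₁ h₂
      obtain ⟨w₁, hw₁, s₁, t₁, hs₁, ht₁, hst₁, rfl⟩ := h₁
      obtain ⟨w₂, hw₂, s₂, t₂, hs₂, ht₂, hst₂, rfl⟩ := h₂
      obtain ⟨a, b, ha, hb, hab, habx⟩ := hseg
      rcases (show 0 ≤ a * t₁ + b * t₂ by positivity).eq_or_lt with h0 | h0
      · have h1 : a * t₁ = 0 := by nlinarith [mul_nonneg ha.le ht₁, mul_nonneg hb.le ht₂]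
        have h1' : t₁ = 0 := (mul_eq_zero.1 h1).resolve_left ha.ne'
        have h3 : s₁ = 1 := by linarith
        simp [h1', h3]
      · exfalso
        apply hx
        set c := a * t₁ + b * t₂ with hc
        have hx' : x = (a * t₁ / c) • w₁ + (b * t₂ / c) • w₂ := by
          have h6 : c • x = (a * t₁) • w₁ + (b * t₂) • w₂ := by
            have h7 : c = 1 - a * s₁ - b * s₂ := by
              linear_combination hc + a * hst₁ + b * hst₂ + hab
            rw [h7, sub_smul, sub_smul, one_smul]
            nth_rewrite 1 [← habx]
            module
          have h8 := congrArg (fun z => c⁻¹ • z) h6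
          simp only [smul_smul, smul_add, inv_mul_cancel₀ h0.ne', one_smul] at h8
          rw [div_eq_inv_mul, div_eq_inv_mul]
          exact h8
        have h9 := convex_convexHull ℝ _ hw₁ hw₂ (a := a * t₁ / c) (b := b * t₂ / c) (by positivity)
          (by positivity) (by rw [← add_div, div_self h0.ne'])
        rwa [← hx'] at h9

theorem openTriangle_subset_triangle : openTriangle ⊆ triangle := by
  rintro p ⟨h1, h2, h3⟩
  have := mem_convexHull_of_sides (v := (0, 0)) (p := p) (by simp) h3.le
    (by simpa [raySide] using h2.le) (by simpa [chordSide] using h1.le)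
  refine convexHull_mono ?_ this
  rintro w (rfl | rfl | rfl) <;> simp

theorem triangle_subset : triangle ⊆ {p | 0 ≤ p.1 ∧ 0 ≤ p.2 ∧ p.1 + p.2 ≤ 1} := by
  refine convexHull_min ?_ ?_
  · rintro w (rfl | rfl | rfl) <;> simp
  · rintro x ⟨hx1, hx2, hx3⟩ y ⟨hy1, hy2, hy3⟩ a b ha hb hab
    refine ⟨?_, ?_, ?_⟩
    · simp; positivity
    · simp; positivity
    · simp; nlinarith

/-- Injectivity matters because `chainCount` works with indices: a repeated point lies in the hull
of the points with other indices and would not be counted, even if it is a vertex. -/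
theorem numVertices_eq_chainCount_add_two {n : ℕ} {x : Fin n → ℝ × ℝ}
    (hx : ∀ j, x j ∈ openTriangle) (hinj : Function.Injective x) :
    numVertices x = chainCount (1, 0) (0, 1) x + 2 := by
  have hA : ∀ j, x j ≠ (1, 0) := fun j h => by
    have := (hx j).2.1
    simp [h] at this
  have hB : ∀ j, x j ≠ (0, 1) := fun j h => by
    have := (hx j).1
    simp [h] at this
  have hext : (convexHull ℝ ({((1 : ℝ), (0 : ℝ)), (0, 1)} ∪ Set.range x)).extremePoints ℝ =
      insert ((1 : ℝ), (0 : ℝ)) (insert ((0 : ℝ), (1 : ℝ))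
        (x '' {j | x j ∉ convexHull ℝ ({((1 : ℝ), (0 : ℝ)), (0, 1)} ∪ x '' {j}ᶜ)})) := by
    ext p
    rw [mem_extremePoints_convexHull_iff]
    have hdiff : ∀ j, ({((1 : ℝ), (0 : ℝ)), (0, 1)} ∪ Set.range x) \ {x j} =
        {((1 : ℝ), (0 : ℝ)), (0, 1)} ∪ x '' {j}ᶜ := by
      intro j
      ext q
      simp only [Set.mem_sdiff, Set.mem_union, Set.mem_singleton_iff, Set.mem_image,
        Set.mem_compl_iff, Set.mem_insert_iff, Set.mem_range]
      constructor
      · rintro ⟨(h | ⟨l, rfl⟩), hq⟩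
        · exact Or.inl h
        · exact Or.inr ⟨l, fun h => hq (h ▸ rfl), rfl⟩
      · rintro ((rfl | rfl) | ⟨l, hl, rfl⟩)
        · exact ⟨Or.inl (Or.inl rfl), (hA j).symm⟩
        · exact ⟨Or.inl (Or.inr rfl), (hB j).symm⟩
        · exact ⟨Or.inr ⟨l, rfl⟩, fun h => hl (hinj h)⟩
    constructor
    · rintro ⟨(rfl | rfl) | ⟨j, rfl⟩, hp⟩
      · simp
      · simp
      · rw [hdiff] at hp
        exact Or.inr (Or.inr ⟨j, hp, rfl⟩)
    · rintro (rfl | rfl | ⟨j, hj, rfl⟩)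
      · refine ⟨by simp, fun h => ?_⟩
        have hc : Convex ℝ {p : ℝ × ℝ | p.1 < 1} :=
          convex_halfSpace_lt (f := Prod.fst) ⟨fun _ _ => rfl, fun _ _ => rfl⟩ 1
        have : ((1 : ℝ), (0 : ℝ)) ∈ {p : ℝ × ℝ | p.1 < 1} := by
          refine convexHull_min ?_ hc h
          rintro w ⟨(rfl | rfl) | ⟨j, rfl⟩, hw⟩
          · simp at hw
          · simp
          · obtain ⟨h1, h2, h3⟩ := hx j
            simp only [Set.mem_ofPred_eq]; linarith
        simp at this
      · refine ⟨by simp, fun h => ?_⟩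
        have hc : Convex ℝ {p : ℝ × ℝ | p.2 < 1} :=
          convex_halfSpace_lt (f := Prod.snd) ⟨fun _ _ => rfl, fun _ _ => rfl⟩ 1
        have : ((0 : ℝ), (1 : ℝ)) ∈ {p : ℝ × ℝ | p.2 < 1} := by
          refine convexHull_min ?_ hc h
          rintro w ⟨(rfl | rfl) | ⟨j, rfl⟩, hw⟩
          · simp
          · simp at hw
          · obtain ⟨h1, h2, h3⟩ := hx j
            simp only [Set.mem_ofPred_eq]; linarith
        simp at this
      · refine ⟨Or.inr ⟨j, rfl⟩, ?_⟩
        rw [hdiff]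
        exact hj
  unfold numVertices chainHull chainCount
  rw [hext, Set.ncard_insert_of_notMem, Set.ncard_insert_of_notMem,
    Set.ncard_image_of_injective _ hinj]
  · rintro ⟨j, -, hj⟩
    exact hB j hj
  · rintro (h | ⟨j, -, hj⟩)
    · simp at h
    · exact hA j hj

/-! ### Measurability of the chain count -/

theorem convexHull_range_eq_image {E κ : Type*} [Fintype κ] [AddCommGroup E] [Module ℝ E]
    (z : κ → E) : convexHull ℝ (Set.range z) = (fun w : κ → ℝ => ∑ i, w i • z i) ''
      stdSimplex ℝ κ := by
  classical
  have : (fun w : κ → ℝ => ∑ i, w i • z i) = Fintype.linearCombination ℝ z := by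
    ext1 w; simp [Fintype.linearCombination_apply]
  rw [← convexHull_rangle_single_eq_stdSimplex, this, LinearMap.image_convexHull,
    ← Set.range_comp]
  congr 2
  ext1 i
  simp

/-- Membership means that suitable weights exist in a compact simplex, and projecting a closed set
along a compact factor gives a closed set. -/
theorem isClosed_mem_convexHull_others {ι : Type*} [Fintype ι] (a b : ℝ × ℝ) (j : ι) :
    IsClosed {y : ι → ℝ × ℝ | y j ∈ convexHull ℝ ({a, b} ∪ y '' {j}ᶜ)} := by
  classical
  -- The slot `j`, which must be left out, is reused for `a`, and `none` holds `b`; thus the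
  -- generators have a fixed index type and depend continuously on `y`.
  let z : (ι → ℝ × ℝ) → Option ι → ℝ × ℝ := fun y o => o.elim b (Function.update y j a)
  have hz : ∀ y : ι → ℝ × ℝ, ({a, b} ∪ y '' {j}ᶜ : Set (ℝ × ℝ)) = Set.range (z y) := by
    intro y
    ext p
    constructor
    · rintro ((rfl | rfl) | ⟨l, hl, rfl⟩)
      · exact ⟨some j, by simp [z]⟩
      · exact ⟨none, rfl⟩
      · exact ⟨some l, by simp [z, Function.update_of_ne hl]⟩
    · rintro ⟨(_ | l), rfl⟩
      · exact Or.inl (by simp [z])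
      · rcases eq_or_ne l j with rfl | hl
        · exact Or.inl (by simp [z])
        · exact Or.inr ⟨l, hl, by simp [z, Function.update_of_ne hl]⟩
  have hzc : ∀ o, Continuous fun y => z y o := by
    rintro (_ | l)
    · exact continuous_const
    · rcases eq_or_ne l j with rfl | hl
      · simpa [z] using (continuous_const : Continuous fun _ : ι → ℝ × ℝ => a)
      · have : (fun y => z y (some l)) = fun y => y l := by
          ext1 y; simp [z, Function.update_of_ne hl]
        rw [this]
        exact continuous_apply l
  have heq : {y : ι → ℝ × ℝ | y j ∈ convexHull ℝ ({a, b} ∪ y '' {j}ᶜ)} =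
      Prod.snd '' {q : stdSimplex ℝ (Option ι) × (ι → ℝ × ℝ) |
        ∑ o, q.1.1 o • z q.2 o = q.2 j} := by
    ext y
    rw [Set.mem_ofPred_eq, hz, convexHull_range_eq_image]
    constructor
    · rintro ⟨w, hw, hwy⟩
      exact ⟨(⟨w, hw⟩, y), hwy, rfl⟩
    · rintro ⟨⟨w, y⟩, hwy, rfl⟩
      exact ⟨w.1, w.2, hwy⟩
  rw [heq]
  refine isClosedMap_snd_of_compactSpace _ (isClosed_eq ?_ ?_)
  · refine continuous_finsetSum _ fun o _ =>
      Continuous.smul (f := fun q : stdSimplex ℝ (Option ι) × (ι → ℝ × ℝ) => q.1.1 o)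
        (g := fun q => z q.2 o) ?_ ((hzc o).comp continuous_snd)
    exact (continuous_apply o).comp (continuous_subtype_val.comp continuous_fst)
  · exact (continuous_apply j).comp continuous_snd

theorem measurable_chainCount {ι : Type*} [Fintype ι] (a b : ℝ × ℝ) :
    Measurable (chainCount a b : (ι → ℝ × ℝ) → ℕ) := by
  classical
  have : (chainCount a b : (ι → ℝ × ℝ) → ℕ) = fun y =>
      ∑ j, if y j ∈ convexHull ℝ ({a, b} ∪ y '' {j}ᶜ) then 0 else 1 := by
    ext y
    rw [chainCount, Set.ncard_eq_toFinset_card', Finset.sum_ite]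
    simp [Finset.filter]
  rw [this]
  exact Finset.measurable_sum _ fun j _ => Measurable.ite
    (isClosed_mem_convexHull_others a b j).measurableSet measurable_const measurable_const

/-! ### The uniform law on the triangle and null sets -/

theorem continuous_raySide (v : ℝ × ℝ) : Continuous (raySide v) := by
  unfold raySide; fun_prop

theorem continuous_chordSide (v : ℝ × ℝ) : Continuous (chordSide v) := by
  unfold chordSide; fun_prop

theorem measurableSet_openTriangle : MeasurableSet openTriangle := by
  refine IsOpen.measurableSet ?_
  exact (isOpen_lt continuous_const continuous_fst).inter
    ((isOpen_lt continuous_const continuous_snd).inter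
      (isOpen_lt (continuous_fst.add continuous_snd) continuous_const))

theorem openTriangle_eq_regionBetween :
    openTriangle = regionBetween (fun _ => 0) (fun x => 1 - x) (Set.Ioo 0 1) := by
  ext p
  simp only [openTriangle, regionBetween, Set.mem_ofPred_eq, Set.mem_Ioo]
  constructor
  · rintro ⟨h1, h2, h3⟩
    exact ⟨⟨h1, by linarith⟩, h2, by linarith⟩
  · rintro ⟨⟨h1, -⟩, h2, h3⟩
    exact ⟨h1, h2, by linarith⟩

theorem volume_openTriangle : volume openTriangle = 2⁻¹ := by
  rw [openTriangle_eq_regionBetween, Measure.volume_eq_prod,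
    volume_regionBetween_eq_integral integrableOn_zero _ measurableSet_Ioo]
  · rw [← integral_Ioc_eq_integral_Ioo, ← intervalIntegral.integral_of_le zero_le_one]
    have : ∫ x : ℝ in 0..1, ((fun x : ℝ => 1 - x) - fun _ : ℝ => (0 : ℝ)) x = 1 / 2 := by
      simp only [Pi.sub_apply, sub_zero]
      rw [intervalIntegral.integral_sub (by simp) (by simp)]
      simp
      norm_num
    rw [this, ← ENNReal.ofReal_ofNat, ← ENNReal.ofReal_inv_of_pos (by norm_num)]
    norm_num
  · intro x hx
    linarith [hx.2]
  · exact (Continuous.integrableOn_Icc (by fun_prop)).mono_set Set.Ioo_subset_Icc_self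

theorem volume_graph_eq_zero {f : ℝ → ℝ} (hf : Measurable f) :
    volume {p : ℝ × ℝ | p.2 = f p.1} = 0 := by
  have hm : MeasurableSet {p : ℝ × ℝ | p.2 = f p.1} :=
    measurableSet_eq_fun measurable_snd (hf.comp measurable_fst)
  rw [Measure.volume_eq_prod, Measure.measure_prod_null hm]
  filter_upwards with x
  simp [Set.preimage]

theorem volume_fst_eq_zero : volume {p : ℝ × ℝ | p.1 = 0} = 0 := by
  have : {p : ℝ × ℝ | p.1 = 0} = {0} ×ˢ Set.univ := by ext p; simp
  rw [this, Measure.volume_eq_prod, Measure.prod_prod]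
  simp

theorem triangle_ae_eq : triangle =ᵐ[volume] openTriangle := by
  refine (ae_eq_set.2 ⟨?_, ?_⟩)
  · refine measure_mono_null (t := {p : ℝ × ℝ | p.1 = 0} ∪
      ({p | p.2 = (fun _ => 0) p.1} ∪ {p | p.2 = (fun x => 1 - x) p.1})) ?_ ?_
    · rintro p ⟨hp, hpo⟩
      obtain ⟨h1, h2, h3⟩ := triangle_subset hp
      by_contra hcon
      simp only [Set.mem_union, Set.mem_ofPred_eq, not_or] at hcon
      obtain ⟨c1, c2, c3⟩ := hcon
      refine hpo ⟨lt_of_le_of_ne h1 (Ne.symm c1), lt_of_le_of_ne h2 (Ne.symm c2),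
        lt_of_le_of_ne h3 fun h => c3 (by linarith)⟩
    · rw [measure_union_null_iff, measure_union_null_iff]
      exact ⟨volume_fst_eq_zero, volume_graph_eq_zero measurable_const,
        volume_graph_eq_zero (by fun_prop)⟩
  · rw [Set.sdiff_eq_empty.2 openTriangle_subset_triangle, measure_empty]

theorem uniformTriangle_eq : uniformTriangle = (2 : ENNReal) • volume.restrict openTriangle := by
  rw [uniformTriangle, ProbabilityTheory.cond, measure_congr triangle_ae_eq,
    Measure.restrict_congr_set triangle_ae_eq, volume_openTriangle, inv_inv]

instance : IsProbabilityMeasure uniformTriangle := by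
  constructor
  rw [uniformTriangle_eq, Measure.smul_apply, Measure.restrict_apply_univ, volume_openTriangle,
    smul_eq_mul, ENNReal.mul_inv_cancel (by norm_num) (by norm_num)]

instance (n : ℕ) : IsProbabilityMeasure (pointsLaw n) := by
  unfold pointsLaw; infer_instance

theorem ae_mem_openTriangle : ∀ᵐ p ∂uniformTriangle, p ∈ openTriangle := by
  rw [uniformTriangle_eq]
  exact Measure.ae_smul_measure (ae_restrict_mem measurableSet_openTriangle) _

theorem uniformTriangle_eq_zero {s : Set (ℝ × ℝ)} (hs : volume s = 0) : uniformTriangle s = 0 := by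
  rw [uniformTriangle_eq, Measure.smul_apply,
    Measure.absolutelyContinuous_of_le Measure.restrict_le_self hs, smul_zero]

theorem uniformTriangle_raySide_eq_zero {v : ℝ × ℝ} (hv : v ∈ openTriangle) :
    uniformTriangle {p | raySide v p = 0} = 0 := by
  obtain ⟨h1, h2, h3⟩ := hv
  have : {p | raySide v p = 0} = {p | p.2 = (fun x => v.2 * (1 - x) / (1 - v.1)) p.1} := by
    ext p
    have : 1 - v.1 ≠ 0 := by linarith
    simp only [Set.mem_ofPred_eq, raySide]
    rw [eq_div_iff this, sub_eq_zero]
  rw [this]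
  have hm : Measurable fun x : ℝ => v.2 * (1 - x) / (1 - v.1) := by fun_prop
  exact uniformTriangle_eq_zero (volume_graph_eq_zero hm)

/-! ### Corner and hidden regions as affine copies of the triangle -/

/-- The affine map fixing `(0, 1)` that sends `(0, 0)` to `(0, q)` and `(1, 0)` to the point with
first coordinate `s` on the line through `(0, q)` and `(1, 0)`. -/
noncomputable def cornerMap (s q : ℝ) : ℝ × ℝ →ᵃ[ℝ] ℝ × ℝ :=
  (Matrix.toLin (Module.Basis.finTwoProd ℝ) (Module.Basis.finTwoProd ℝ)
    !![s, 0; -(s * q), 1 - q]).toAffineMap + AffineMap.const ℝ (ℝ × ℝ) (0, q)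

theorem cornerMap_apply (s q : ℝ) (p : ℝ × ℝ) :
    cornerMap s q p = (s * p.1, q - s * q * p.1 + (1 - q) * p.2) := by
  simp only [cornerMap, AffineMap.coe_add, Pi.add_apply, LinearMap.coe_toAffineMap,
    Matrix.toLin_finTwoProd_apply, AffineMap.const_apply]
  ext <;> simp
  ring

theorem cornerMap_injective {s q : ℝ} (hs : 0 < s) (hq : q < 1) :
    Function.Injective (cornerMap s q) := by
  intro x y h
  rw [cornerMap_apply, cornerMap_apply, Prod.mk.injEq] at h
  have h1 : x.1 = y.1 := mul_left_cancel₀ hs.ne' h.1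
  have h2 := h.2
  rw [h1] at h2
  exact Prod.ext h1 (mul_left_cancel₀ (sub_pos.2 hq).ne' (by linarith))

theorem measurable_cornerMap (s q : ℝ) : Measurable (cornerMap s q) := by
  have : (cornerMap s q : ℝ × ℝ → ℝ × ℝ) =
      fun p => (s * p.1, q - s * q * p.1 + (1 - q) * p.2) := funext (cornerMap_apply s q)
  rw [this]
  fun_prop

theorem map_cornerMap_volume {s q : ℝ} (hs : 0 < s) (hq : q < 1) :
    volume.map (cornerMap s q) = ENNReal.ofReal ((s * (1 - q))⁻¹) • volume := by
  set L := Matrix.toLin (Module.Basis.finTwoProd ℝ) (Module.Basis.finTwoProd ℝ)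
    !![s, 0; -(s * q), 1 - q] with hL
  have hpos : 0 < s * (1 - q) := mul_pos hs (by linarith)
  have hdet : LinearMap.det L = s * (1 - q) := by
    rw [hL, LinearMap.det_toLin, Matrix.det_fin_two_of]; ring
  have hcomp : (cornerMap s q : ℝ × ℝ → ℝ × ℝ) = (fun p => p + (0, q)) ∘ L := by
    ext1 p; simp [cornerMap, hL]
  have hLm : Measurable L := L.continuous_of_finiteDimensional.measurable
  rw [hcomp, ← Measure.map_map (by fun_prop) hLm,
    Measure.map_linearMap_addHaar_eq_smul_addHaar _ (by rw [hdet]; exact hpos.ne'), hdet,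
    abs_of_pos (inv_pos.2 hpos), Measure.map_smul, map_add_right_eq_self]

/-- An affine map has constant Jacobian, here `s * (1 - q)`, so it transports the uniform law to the
uniform law on its image up to this factor, which is therefore the probability of `D`. -/
theorem uniformTriangle_restrict_eq {s q : ℝ} (hs : 0 < s) (hq : q < 1) {D : Set (ℝ × ℝ)}
    (hD : MeasurableSet D) (hDT : D ⊆ openTriangle)
    (hpre : cornerMap s q ⁻¹' D = openTriangle) :
    uniformTriangle.restrict D =
      ENNReal.ofReal (s * (1 - q)) • uniformTriangle.map (cornerMap s q) := by
  have hpos : 0 < s * (1 - q) := mul_pos hs (by linarith)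
  have h1 : (volume.restrict openTriangle).map (cornerMap s q) =
      ENNReal.ofReal ((s * (1 - q))⁻¹) • volume.restrict D := by
    rw [← hpre, ← Measure.restrict_map (measurable_cornerMap s q) hD, map_cornerMap_volume hs hq,
      Measure.restrict_smul]
  rw [uniformTriangle_eq, Measure.map_smul, h1, Measure.restrict_smul,
    Measure.restrict_restrict hD, Set.inter_eq_left.2 hDT, smul_smul, smul_smul,
    mul_comm _ (2 : ENNReal), mul_assoc, ← ENNReal.ofReal_mul hpos.le,
    mul_inv_cancel₀ hpos.ne', ENNReal.ofReal_one, mul_one]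

/-- The part of the triangle beyond the chord from `v` to `(0, 1)` and on the inner side of the
line through `(1, 0)` and `v`. -/
def cornerRegion (v : ℝ × ℝ) : Set (ℝ × ℝ) :=
  {p | 0 < p.1 ∧ 0 < raySide v p ∧ chordSide v p < 0}

/-- The part of the triangle between the chords from `v` to `(1, 0)` and `(0, 1)`. -/
def hiddenRegion (v : ℝ × ℝ) : Set (ℝ × ℝ) :=
  {p | p ∈ openTriangle ∧ 0 < raySide v p ∧ 0 ≤ chordSide v p}

theorem measurableSet_cornerRegion (v : ℝ × ℝ) : MeasurableSet (cornerRegion v) := by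
  refine IsOpen.measurableSet ?_
  exact (isOpen_lt continuous_const continuous_fst).inter
    ((isOpen_lt continuous_const (continuous_raySide v)).inter
      (isOpen_lt (continuous_chordSide v) continuous_const))

theorem measurableSet_hiddenRegion (v : ℝ × ℝ) : MeasurableSet (hiddenRegion v) :=
  measurableSet_openTriangle.inter
    ((isOpen_lt continuous_const (continuous_raySide v)).measurableSet.inter
      (isClosed_le continuous_const (continuous_chordSide v)).measurableSet)

section Regions

variable {v : ℝ × ℝ}

theorem mul_neg_iff_right_of_pos {a b : ℝ} (ha : 0 < a) : a * b < 0 ↔ b < 0 := by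
  rw [← neg_pos, ← mul_neg, mul_pos_iff_of_pos_left ha, neg_pos]

theorem slope_lt_one (hv : v ∈ openTriangle) : v.2 / (1 - v.1) < 1 := by
  obtain ⟨h1, h2, h3⟩ := hv
  rw [div_lt_one (by linarith)]; linarith

theorem slope_pos (hv : v ∈ openTriangle) : 0 < v.2 / (1 - v.1) := by
  obtain ⟨h1, h2, h3⟩ := hv
  exact div_pos h2 (by linarith)

/-- Pulled back by `cornerMap`, the side functions become positive multiples of `p.2` and, when `s =
v.1`, of `p.1 + p.2 - 1`: the region inequalities turn into those defining the open triangle. -/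
theorem raySide_cornerMap (hv : v ∈ openTriangle) (s : ℝ) (p : ℝ × ℝ) :
    raySide v (cornerMap s (v.2 / (1 - v.1)) p) =
      (1 - v.1) * (1 - v.2 / (1 - v.1)) * p.2 := by
  obtain ⟨h1, h2, h3⟩ := hv
  have : 1 - v.1 ≠ 0 := by linarith
  rw [cornerMap_apply]
  simp only [raySide]
  field_simp
  ring

theorem chordSide_cornerMap (hv : v ∈ openTriangle) (p : ℝ × ℝ) :
    chordSide v (cornerMap v.1 (v.2 / (1 - v.1)) p) =
      v.1 * (1 - v.2 / (1 - v.1)) * (p.1 + p.2 - 1) := by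
  obtain ⟨h1, h2, h3⟩ := hv
  have : 1 - v.1 ≠ 0 := by linarith
  rw [cornerMap_apply]
  simp only [chordSide]
  field_simp
  ring

theorem cornerRegion_subset (hv : v ∈ openTriangle) : cornerRegion v ⊆ openTriangle := by
  obtain ⟨h1, h2, h3⟩ := hv
  rintro p ⟨hp1, hp2, hp3⟩
  simp only [raySide, chordSide] at hp2 hp3
  have e : (1 - v.1 - v.2) * p.1 < v.1 * (1 - v.1 - v.2) := by
    nlinarith
  have hp1' : p.1 < v.1 := by
    rw [mul_comm] at e
    exact lt_of_mul_lt_mul_right e (by linarith)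
  refine ⟨hp1, ?_, ?_⟩
  · nlinarith
  · by_contra! h
    nlinarith

theorem cornerMap_preimage_cornerRegion (hv : v ∈ openTriangle) :
    cornerMap v.1 (v.2 / (1 - v.1)) ⁻¹' cornerRegion v = openTriangle := by
  have hq := slope_lt_one hv
  have hv' := hv
  obtain ⟨h1, h2, h3⟩ := hv
  have hc : 0 < 1 - v.2 / (1 - v.1) := by linarith
  have hc' : 0 < 1 - v.1 := by linarith
  ext p
  simp only [Set.mem_preimage, cornerRegion, Set.mem_ofPred_eq, raySide_cornerMap hv',
    chordSide_cornerMap hv', openTriangle]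
  rw [cornerMap_apply, mul_pos_iff_of_pos_left h1, mul_pos_iff_of_pos_left (mul_pos hc' hc),
    mul_neg_iff_right_of_pos (mul_pos h1 hc), sub_neg]

/-- With `s = 1` the image is everything beyond the ray, both regions together; the hidden region is
then obtained by subtraction. -/
theorem cornerMap_preimage_inner (hv : v ∈ openTriangle) :
    cornerMap 1 (v.2 / (1 - v.1)) ⁻¹' {p | p ∈ openTriangle ∧ 0 < raySide v p} =
      openTriangle := by
  have hq := slope_lt_one hv
  have hq0 := slope_pos hv
  have hv' := hv
  obtain ⟨h1, h2, h3⟩ := hv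
  have hc : 0 < 1 - v.2 / (1 - v.1) := by linarith
  have hc' : 0 < 1 - v.1 := by linarith
  ext p
  simp only [Set.mem_preimage, Set.mem_ofPred_eq, raySide_cornerMap hv', openTriangle]
  rw [cornerMap_apply, mul_pos_iff_of_pos_left (mul_pos hc' hc)]
  set q := v.2 / (1 - v.1)
  simp only
  constructor
  · rintro ⟨⟨ha, hb, hd⟩, he⟩
    refine ⟨by linarith, he, ?_⟩
    have : (1 - q) * (p.1 + p.2 - 1) < 0 := by linarith
    have := (mul_neg_iff_right_of_pos hc).1 this
    linarith
  · rintro ⟨ha, hb, hd⟩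
    have : (1 - q) * (p.1 + p.2 - 1) < 0 := (mul_neg_iff_right_of_pos hc).2 (by linarith)
    refine ⟨⟨by linarith, ?_, by linarith⟩, hb⟩
    have h5 : 0 < q * (1 - p.1) := mul_pos hq0 (by linarith)
    have h6 : 0 < (1 - q) * p.2 := mul_pos hc hb
    linarith

theorem uniformTriangle_restrict_cornerRegion (hv : v ∈ openTriangle) :
    uniformTriangle.restrict (cornerRegion v) = ENNReal.ofReal (v.1 * (1 - v.2 / (1 - v.1))) •
      uniformTriangle.map (cornerMap v.1 (v.2 / (1 - v.1))) :=
  uniformTriangle_restrict_eq hv.1 (slope_lt_one hv) (measurableSet_cornerRegion v)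
    (cornerRegion_subset hv) (cornerMap_preimage_cornerRegion hv)

theorem uniformTriangle_cornerRegion (hv : v ∈ openTriangle) :
    uniformTriangle (cornerRegion v) = ENNReal.ofReal (v.1 * (1 - v.2 / (1 - v.1))) := by
  have := congrArg (fun m => m Set.univ) (uniformTriangle_restrict_cornerRegion hv)
  simpa [Measure.map_apply (measurable_cornerMap _ _) MeasurableSet.univ] using this

theorem uniformTriangle_hiddenRegion (hv : v ∈ openTriangle) :
    uniformTriangle (hiddenRegion v) =
      ENNReal.ofReal ((1 - v.1) * (1 - v.2 / (1 - v.1))) := by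
  have hm : MeasurableSet {p | p ∈ openTriangle ∧ 0 < raySide v p} :=
    measurableSet_openTriangle.inter
      (isOpen_lt continuous_const (continuous_raySide v)).measurableSet
  have h1 := congrArg (fun m => m Set.univ) (uniformTriangle_restrict_eq one_pos
    (slope_lt_one hv) hm (fun p hp => hp.1) (cornerMap_preimage_inner hv))
  simp only [Measure.restrict_apply_univ, Measure.smul_apply, smul_eq_mul,
    Measure.map_apply (measurable_cornerMap _ _) MeasurableSet.univ, Set.preimage_univ,
    measure_univ, mul_one, one_mul] at h1
  have h2 : hiddenRegion v = {p | p ∈ openTriangle ∧ 0 < raySide v p} \ cornerRegion v := by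
    ext p
    simp only [hiddenRegion, cornerRegion, Set.mem_ofPred_eq, Set.mem_sdiff]
    constructor
    · rintro ⟨ha, hb, hc⟩
      exact ⟨⟨ha, hb⟩, fun h => absurd h.2.2 (not_lt.2 hc)⟩
    · rintro ⟨⟨ha, hb⟩, hc⟩
      exact ⟨ha, hb, not_lt.1 fun h => hc ⟨ha.1, hb, h⟩⟩
  have hq := slope_lt_one hv
  have hsub : cornerRegion v ⊆ {p | p ∈ openTriangle ∧ 0 < raySide v p} :=
    fun p hp => ⟨cornerRegion_subset hv hp, hp.2.1⟩
  rw [h2, measure_sdiff hsub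
    (measurableSet_cornerRegion v).nullMeasurableSet (measure_ne_top _ _), h1,
    uniformTriangle_cornerRegion hv,
    ← ENNReal.ofReal_sub _ (mul_nonneg hv.1.le (by linarith))]
  congr 1
  ring

end Regions

/-! ### Conditional law of the chain given its first vertex -/

/-- The distribution of `chainCount` for `n` independent uniformly distributed points. -/
noncomputable def countProb (n k : ℕ) : ENNReal :=
  pointsLaw n {x | chainCount (1, 0) (0, 1) x = k}

theorem measurableSet_chainCount_eq {ι : Type*} [Fintype ι] (a b : ℝ × ℝ) (k : ℕ) :
    MeasurableSet {y : ι → ℝ × ℝ | chainCount a b y = k} :=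
  measurable_chainCount a b (measurableSet_singleton k)

theorem pi_uniformTriangle_chainCount_eq {ι : Type*} [Fintype ι] (k : ℕ) :
    Measure.pi (fun _ : ι => uniformTriangle) {y | chainCount (1, 0) (0, 1) y = k} =
      countProb (Fintype.card ι) k := by
  let e := Fintype.equivFin ι
  have h := measurePreserving_piCongrLeft (α := fun _ : Fin (Fintype.card ι) => ℝ × ℝ)
    (fun _ => uniformTriangle) e
  rw [countProb, pointsLaw, ← h.measure_preimage
    (measurableSet_chainCount_eq _ _ k).nullMeasurableSet]
  congr 1
  ext y
  simp only [Set.mem_preimage, Set.mem_ofPred_eq]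
  rw [← chainCount_comp_equiv e]
  have : (MeasurableEquiv.piCongrLeft (fun _ => ℝ × ℝ) e) y ∘ e = y := by
    ext1 j
    exact Equiv.piCongrLeft_apply_apply (fun _ => ℝ × ℝ) e y j
  rw [this]

theorem pi_smul_const {ι α : Type*} [Fintype ι] [MeasurableSpace α] (μ : Measure α)
    [IsFiniteMeasure μ] {c : ENNReal} (hc : c ≠ ⊤) :
    Measure.pi (fun _ : ι => c • μ) = c ^ Fintype.card ι • Measure.pi (fun _ : ι => μ) := by
  have : IsFiniteMeasure (c • μ) := μ.smul_finite hc
  refine Measure.pi_eq fun s _ => ?_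
  simp [Measure.pi_pi, Finset.prod_mul_distrib]

/-- Self-similarity: `cornerMap` carries `(1, 0)` to `v` and fixes `(0, 1)`, so points restricted to
the corner region are affine images of uniform points in `T`, each contributing one factor of mass.
-/
theorem pi_cornerRegion_chainCount {σ : Type*} [Fintype σ] {v : ℝ × ℝ} (hv : v ∈ openTriangle)
    (k : ℕ) :
    Measure.pi (fun _ : σ => uniformTriangle)
        {z | (∀ j, z j ∈ cornerRegion v) ∧ chainCount v (0, 1) z = k} =
      ENNReal.ofReal (v.1 * (1 - v.2 / (1 - v.1))) ^ Fintype.card σ *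
        countProb (Fintype.card σ) k := by
  set ψ := cornerMap v.1 (v.2 / (1 - v.1)) with hψ
  have hm := measurableSet_chainCount_eq (ι := σ) v (0, 1) k
  have hset : {z : σ → ℝ × ℝ | (∀ j, z j ∈ cornerRegion v) ∧ chainCount v (0, 1) z = k} =
      {z | chainCount v (0, 1) z = k} ∩ Set.univ.pi fun _ => cornerRegion v := by
    ext z; simp [and_comm]
  have : IsProbabilityMeasure (uniformTriangle.map ψ) :=
    Measure.isProbabilityMeasure_map (measurable_cornerMap _ _).aemeasurable
  have hmeas : Measurable fun (x : σ → ℝ × ℝ) i => ψ (x i) :=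
    measurable_pi_lambda _ fun j => (measurable_cornerMap _ _).comp (measurable_pi_apply j)
  rw [hset, ← Measure.restrict_apply hm, Measure.restrict_pi_pi,
    uniformTriangle_restrict_cornerRegion hv, pi_smul_const _ ENNReal.ofReal_ne_top,
    Measure.smul_apply, smul_eq_mul, ← hψ,
    ← Measure.pi_map_pi (f := fun _ => ψ) (fun _ => (measurable_cornerMap _ _).aemeasurable),
    Measure.map_apply hmeas hm,
    ← pi_uniformTriangle_chainCount_eq]
  congr 2
  ext z
  simp only [Set.mem_preimage, Set.mem_ofPred_eq]
  have hvA : ψ (1, 0) = v := by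
    have := hv.2.2
    have : 1 - v.1 ≠ 0 := by linarith [hv.2.1]
    rw [hψ, cornerMap_apply]
    ext
    · simp
    · simp; field_simp
  have hvB : ψ (0, 1) = (0, 1) := by
    rw [hψ, cornerMap_apply]; simp
  conv_lhs => rw [← hvB]
  nth_rewrite 1 [← hvA]
  rw [chainCount_map ψ (cornerMap_injective hv.1 (slope_lt_one hv))]

/-- The configurations for which exactly the points with index in `S` lie beyond the chord, and
form `k` vertices. -/
def splitEvent {n : ℕ} (v : ℝ × ℝ) (S : Finset (Fin n)) (k : ℕ) : Set (Fin n → ℝ × ℝ) :=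
  {y | ((∀ j : {j // j ∈ S}, y j ∈ cornerRegion v) ∧
    chainCount v (0, 1) (fun j : {j // j ∈ S} => y j) = k) ∧
    ∀ j : {j // j ∉ S}, y j ∈ hiddenRegion v}

theorem measurableSet_splitEvent {n : ℕ} (v : ℝ × ℝ) (S : Finset (Fin n)) (k : ℕ) :
    MeasurableSet (splitEvent v S k) := by
  refine MeasurableSet.inter (MeasurableSet.inter ?_ ?_) ?_
  · have : {y : Fin n → ℝ × ℝ | ∀ j : {j // j ∈ S}, y j ∈ cornerRegion v} =
        ⋂ j : {j // j ∈ S}, (fun y => y j) ⁻¹' cornerRegion v := by ext; simp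
    exact (MeasurableSet.iInter fun j : {j // j ∈ S} =>
      (show Measurable fun y : Fin n → ℝ × ℝ => y j.1 by fun_prop)
        (measurableSet_cornerRegion v)).congr this.symm
  · have : Measurable fun (y : Fin n → ℝ × ℝ) (j : {j // j ∈ S}) => y j := by fun_prop
    exact this (measurableSet_chainCount_eq v (0, 1) k)
  · have : {y : Fin n → ℝ × ℝ | ∀ j : {j // j ∉ S}, y j ∈ hiddenRegion v} =
        ⋂ j : {j // j ∉ S}, (fun y => y j) ⁻¹' hiddenRegion v := by ext; simp
    exact (MeasurableSet.iInter fun j : {j // j ∉ S} =>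
      (show Measurable fun y : Fin n → ℝ × ℝ => y j.1 by fun_prop)
        (measurableSet_hiddenRegion v)).congr this.symm

theorem pointsLaw_splitEvent {n : ℕ} {v : ℝ × ℝ} (hv : v ∈ openTriangle) (S : Finset (Fin n))
    (k : ℕ) :
    pointsLaw n (splitEvent v S k) =
      ENNReal.ofReal (v.1 * (1 - v.2 / (1 - v.1))) ^ S.card * countProb S.card k *
        ENNReal.ofReal ((1 - v.1) * (1 - v.2 / (1 - v.1))) ^ (n - S.card) := by
  have h : MeasurePreserving (MeasurableEquiv.piEquivPiSubtypeProd (fun _ : Fin n => ℝ × ℝ)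
      (fun j => j ∈ S)) (Measure.pi fun _ => uniformTriangle)
      ((Measure.pi fun _ : {j // j ∈ S} => uniformTriangle).prod
        (Measure.pi fun _ : {j // j ∉ S} => uniformTriangle)) := by
    convert measurePreserving_piEquivPiSubtypeProd (α := fun _ : Fin n => ℝ × ℝ)
      (fun _ => uniformTriangle) (fun j => j ∈ S)
  have hset : splitEvent v S k = MeasurableEquiv.piEquivPiSubtypeProd (fun _ => ℝ × ℝ)
      (fun j => j ∈ S) ⁻¹' ({z | (∀ j, z j ∈ cornerRegion v) ∧ chainCount v (0, 1) z = k} ×ˢ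
        Set.univ.pi fun _ => hiddenRegion v) := by
    ext y
    simp only [splitEvent, Set.mem_preimage, Set.mem_prod, Set.mem_ofPred_eq, Set.mem_univ_pi]
    rfl
  have hm : MeasurableSet ({z | (∀ j, z j ∈ cornerRegion v) ∧ chainCount v (0, 1) z = k} :
      Set ({j // j ∈ S} → ℝ × ℝ)) := by
    refine MeasurableSet.inter ?_ (measurableSet_chainCount_eq v (0, 1) k)
    have : {z : {j // j ∈ S} → ℝ × ℝ | ∀ j, z j ∈ cornerRegion v} =
      Set.univ.pi fun _ => cornerRegion v := by ext; simp
    exact (MeasurableSet.univ_pi fun _ => measurableSet_cornerRegion v).congr this.symm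
  rw [pointsLaw, hset, h.measure_preimage (hm.prod (MeasurableSet.univ_pi fun _ =>
    measurableSet_hiddenRegion v)).nullMeasurableSet, Measure.prod_prod, Measure.pi_pi,
    pi_cornerRegion_chainCount hv, Finset.prod_const, uniformTriangle_hiddenRegion hv]
  simp [Fintype.card_subtype_compl]

theorem ae_forall_mem_openTriangle (n : ℕ) :
    ∀ᵐ y ∂pointsLaw n, ∀ j, y j ∈ openTriangle := by
  rw [ae_all_iff]
  intro j
  exact (measurePreserving_eval (fun _ : Fin n => uniformTriangle) j).quasiMeasurePreserving.ae
    ae_mem_openTriangle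

/-- Up to a null set the event is the disjoint union, over the set `S` of points beyond the chord,
of the split events. Their probabilities depend only on the size `m` of `S`, which produces the
binomial coefficient. -/
theorem pointsLaw_chainCount_insertNth {n : ℕ} (i : Fin (n + 1)) {v : ℝ × ℝ}
    (hv : v ∈ openTriangle) (k : ℕ) :
    pointsLaw n {y | (∀ j, 0 < raySide v (y j)) ∧
        chainCount (1, 0) (0, 1) (i.insertNth v y : Fin (n + 1) → ℝ × ℝ) = k + 1} =
      ∑ m ∈ Finset.range (n + 1), n.choose m •
        (ENNReal.ofReal (v.1 * (1 - v.2 / (1 - v.1))) ^ m * countProb m k *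
        ENNReal.ofReal ((1 - v.1) * (1 - v.2 / (1 - v.1))) ^ (n - m)) := by
  classical
  have hae : {y : Fin n → ℝ × ℝ | (∀ j, 0 < raySide v (y j)) ∧
        chainCount (1, 0) (0, 1) (i.insertNth v y : Fin (n + 1) → ℝ × ℝ) = k + 1} =ᵐ[pointsLaw n]
      ⋃ S ∈ (Finset.univ : Finset (Fin n)).powerset, splitEvent v S k := by
    refine Filter.eventuallyEq_set.2 ?_
    filter_upwards [ae_forall_mem_openTriangle n] with y hy
    simp only [Set.mem_iUnion, Finset.mem_powerset, Finset.subset_univ,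
      exists_prop, true_and]
    have hsplit : ∀ S : Finset (Fin n), (∀ j, 0 < raySide v (y j)) →
        (∀ j, j ∈ S ↔ chordSide v (y j) < 0) →
        chainCount (1, 0) (0, 1) (i.insertNth v y : Fin (n + 1) → ℝ × ℝ) =
          chainCount v (0, 1) (fun j : {j // j ∈ S} => y j) + 1 := by
      intro S hr hS
      have := chainCount_eq_split (x := (i.insertNth v y : Fin (n + 1) → ℝ × ℝ)) (i := i)
        (p := fun j => j ∈ S) (by simpa using hv) (by simpa using hy) (by simpa using hr)
        (by simpa using hS)
      simpa using this
    constructor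
    · rintro ⟨hr, hc⟩
      set S := Finset.univ.filter fun j => chordSide v (y j) < 0 with hS
      have hS' : ∀ j, j ∈ S ↔ chordSide v (y j) < 0 := by simp [hS]
      refine ⟨S, ⟨fun j => ⟨(hy j).1, hr j, (hS' j).1 j.2⟩, ?_⟩, fun j => ⟨hy j, hr j, ?_⟩⟩
      · have := hsplit S hr hS'
        omega
      · exact not_lt.1 fun h => j.2 ((hS' j).2 h)
    · rintro ⟨S, ⟨hS, hk⟩, hh⟩
      have hr : ∀ j, 0 < raySide v (y j) := by
        intro j
        by_cases hj : j ∈ S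
        · exact (hS ⟨j, hj⟩).2.1
        · exact (hh ⟨j, hj⟩).2.1
      refine ⟨hr, ?_⟩
      rw [hsplit S hr, hk]
      intro j
      constructor
      · exact fun hj => (hS ⟨j, hj⟩).2.2
      · intro hj
        by_contra hjS
        exact absurd hj (not_lt.2 (hh ⟨j, hjS⟩).2.2)
  rw [measure_congr hae, measure_biUnion_finset _ fun S _ => measurableSet_splitEvent v S k]
  · simp_rw [pointsLaw_splitEvent hv]
    rw [Finset.sum_powerset_apply_card (fun m =>
        (ENNReal.ofReal (v.1 * (1 - v.2 / (1 - v.1))) ^ m * countProb m k *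
        ENNReal.ofReal ((1 - v.1) * (1 - v.2 / (1 - v.1))) ^ (n - m)))]
    simp
  · intro S _ R _ hSR
    refine Set.disjoint_left.2 fun y hS hR => hSR ?_
    ext j
    constructor
    · intro hj
      by_contra hj'
      exact absurd (hS.1.1 ⟨j, hj⟩).2.2 (not_lt.2 (hR.2 ⟨j, hj'⟩).2.2)
    · intro hj
      by_contra hj'
      exact absurd (hR.1.1 ⟨j, hj⟩).2.2 (not_lt.2 (hS.2 ⟨j, hj'⟩).2.2)

/-! ### Integration over the first vertex -/

theorem integral_pow_mul_one_sub_pow (a b : ℕ) :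
    ∫ x : ℝ in 0..1, x ^ a * (1 - x) ^ b =
      (a.factorial : ℝ) * b.factorial / (a + b + 1).factorial := by
  induction b generalizing a with
  | zero =>
    simp only [pow_zero, mul_one, integral_pow]
    rw [add_zero, Nat.factorial_succ]
    have : (a.factorial : ℝ) ≠ 0 := by positivity
    have : (a : ℝ) + 1 ≠ 0 := by positivity
    push_cast
    field_simp
    simp
  | succ b ih =>
    -- Integration by parts: this function vanishes at both endpoints, so the integral of its
    -- derivative is zero.
    have hderiv : ∀ x ∈ Set.uIcc (0 : ℝ) 1,
        HasDerivAt (fun x : ℝ => x ^ (a + 1) * (1 - x) ^ (b + 1))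
          ((a + 1) * (x ^ a * (1 - x) ^ (b + 1)) - (b + 1) * (x ^ (a + 1) * (1 - x) ^ b)) x := by
      intro x _
      have h1 := hasDerivAt_pow (a + 1) x
      have h2 := ((hasDerivAt_id x).const_sub 1).pow (b + 1)
      refine (h1.mul h2).congr_deriv ?_
      simp only [Pi.pow_apply, Nat.add_sub_cancel, id]
      push_cast
      ring
    have hint := intervalIntegral.integral_eq_sub_of_hasDerivAt hderiv
      (Continuous.intervalIntegrable (by fun_prop) _ _)
    rw [intervalIntegral.integral_sub (Continuous.intervalIntegrable (by fun_prop) _ _)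
      (Continuous.intervalIntegrable (by fun_prop) _ _), intervalIntegral.integral_const_mul,
      intervalIntegral.integral_const_mul, ih] at hint
    simp only [one_pow, sub_self, ne_eq, Nat.add_eq_zero_iff, one_ne_zero, and_false,
      not_false_eq_true, zero_pow, mul_zero, zero_mul] at hint
    have ha : (a : ℝ) + 1 ≠ 0 := by positivity
    have hf : ((a + 1 + b + 1).factorial : ℝ) ≠ 0 := by positivity
    rw [show a + (b + 1) + 1 = a + 1 + b + 1 by ring, eq_div_iff hf]
    rw [Nat.factorial_succ a] at hint
    rw [Nat.factorial_succ b]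
    push_cast at hint ⊢
    have h3 : ((a : ℝ) + 1) * (∫ x : ℝ in 0..1, x ^ a * (1 - x) ^ (b + 1)) =
      (b + 1) * ((a + 1) * a.factorial * b.factorial / (a + 1 + b + 1).factorial) := by linarith
    field_simp at h3
    linarith

theorem integral_one_sub_div_pow {r : ℝ} (hr : 0 < r) (n : ℕ) :
    ∫ t : ℝ in 0..r, (1 - t / r) ^ n = r / (n + 1) := by
  rw [intervalIntegral.integral_comp_sub_div (fun t => t ^ n) hr.ne']
  simp [hr.ne', integral_pow]
  ring

/-- For fixed first coordinate `s` the inner integral equals $(1-s)/(n+1)$ up to constant factors,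
which raises the exponent `b` by one; a Beta integral in `s` remains. -/
theorem lintegral_openTriangle (a b n : ℕ) :
    ∫⁻ v in openTriangle,
        ENNReal.ofReal (v.1 ^ a * (1 - v.1) ^ b * (1 - v.2 / (1 - v.1)) ^ n) =
      ENNReal.ofReal ((a.factorial : ℝ) * (b + 1).factorial /
        ((n + 1) * (a + b + 2).factorial)) := by
  have hm : Measurable fun v : ℝ × ℝ =>
      ENNReal.ofReal (v.1 ^ a * (1 - v.1) ^ b * (1 - v.2 / (1 - v.1)) ^ n) := by fun_prop
  rw [← lintegral_indicator measurableSet_openTriangle, Measure.volume_eq_prod,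
    lintegral_prod _ (hm.indicator measurableSet_openTriangle).aemeasurable]
  have hinner : ∀ s : ℝ, ∫⁻ t : ℝ, openTriangle.indicator (fun v : ℝ × ℝ =>
      ENNReal.ofReal (v.1 ^ a * (1 - v.1) ^ b * (1 - v.2 / (1 - v.1)) ^ n)) (s, t) =
      (Set.Ioo (0 : ℝ) 1).indicator
        (fun s => ENNReal.ofReal (s ^ a * (1 - s) ^ (b + 1) / (n + 1))) s := by
    intro s
    by_cases hs : s ∈ Set.Ioo (0 : ℝ) 1
    · rw [Set.indicator_of_mem hs]
      have h1 : 0 < 1 - s := by linarith [hs.2]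
      have : (fun t : ℝ => openTriangle.indicator (fun v : ℝ × ℝ =>
          ENNReal.ofReal (v.1 ^ a * (1 - v.1) ^ b * (1 - v.2 / (1 - v.1)) ^ n)) (s, t)) =
          (Set.Ioo 0 (1 - s)).indicator fun t =>
            ENNReal.ofReal (s ^ a * (1 - s) ^ b * (1 - t / (1 - s)) ^ n) := by
        ext1 t
        by_cases ht : t ∈ Set.Ioo 0 (1 - s)
        · rw [Set.indicator_of_mem ht, Set.indicator_of_mem]
          exact ⟨hs.1, ht.1, by simp only; linarith [ht.2]⟩
        · rw [Set.indicator_of_notMem ht, Set.indicator_of_notMem]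
          rintro ⟨_, h2, h3⟩
          exact ht ⟨h2, by simp only at h3; linarith⟩
      rw [this, lintegral_indicator measurableSet_Ioo, ← ofReal_integral_eq_lintegral_ofReal]
      · rw [← integral_Ioc_eq_integral_Ioo, ← intervalIntegral.integral_of_le h1.le,
          intervalIntegral.integral_const_mul, integral_one_sub_div_pow h1]
        congr 1
        ring
      · exact (Continuous.integrableOn_Icc (by fun_prop)).mono_set Set.Ioo_subset_Icc_self
      · filter_upwards [ae_restrict_mem measurableSet_Ioo] with t ht
        have : 0 ≤ 1 - t / (1 - s) := by
          rw [sub_nonneg, div_le_one h1]; exact ht.2.le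
        have := hs.1
        simp only [Pi.zero_apply]
        positivity
    · rw [Set.indicator_of_notMem hs]
      have : (fun t : ℝ => openTriangle.indicator (fun v : ℝ × ℝ =>
          ENNReal.ofReal (v.1 ^ a * (1 - v.1) ^ b * (1 - v.2 / (1 - v.1)) ^ n)) (s, t)) =
          fun _ => 0 := by
        ext1 t
        rw [Set.indicator_of_notMem]
        rintro ⟨h1, h2, h3⟩
        simp only at h1 h2 h3
        exact hs ⟨h1, by linarith⟩
      rw [this, lintegral_zero]
  simp_rw [hinner]
  rw [lintegral_indicator measurableSet_Ioo, ← ofReal_integral_eq_lintegral_ofReal]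
  · rw [← integral_Ioc_eq_integral_Ioo, ← intervalIntegral.integral_of_le zero_le_one,
      intervalIntegral.integral_div, integral_pow_mul_one_sub_pow, div_div, mul_comm (_ + _ : ℝ)]
    rfl
  · exact (Continuous.integrableOn_Icc (by fun_prop)).mono_set Set.Ioo_subset_Icc_self
  · filter_upwards [ae_restrict_mem measurableSet_Ioo] with s hs
    have : 0 < 1 - s := by linarith [hs.2]
    have := hs.1
    simp only [Pi.zero_apply]
    positivity

theorem lintegral_uniformTriangle_split {m n : ℕ} (hmn : m ≤ n) :
    ∫⁻ v, ENNReal.ofReal (v.1 * (1 - v.2 / (1 - v.1))) ^ m *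
        ENNReal.ofReal ((1 - v.1) * (1 - v.2 / (1 - v.1))) ^ (n - m) ∂uniformTriangle =
      ENNReal.ofReal (2 * ((m.factorial : ℝ) * (n - m + 1).factorial /
        ((n + 1) * (n + 2).factorial))) := by
  rw [uniformTriangle_eq, lintegral_smul_measure, ENNReal.ofReal_mul zero_le_two,
    ENNReal.ofReal_ofNat, smul_eq_mul]
  congr 1
  have h := lintegral_openTriangle m (n - m) n
  rw [show m + (n - m) + 2 = n + 2 by omega] at h
  rw [← h]
  refine setLIntegral_congr_fun measurableSet_openTriangle fun v hv => ?_
  have hq := slope_lt_one hv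
  obtain ⟨h1, h2, h3⟩ := hv
  have h4 : 0 ≤ 1 - v.2 / (1 - v.1) := by linarith
  have h5 : 0 ≤ 1 - v.1 := by linarith
  rw [← ENNReal.ofReal_pow (by positivity), ← ENNReal.ofReal_pow (by positivity),
    ← ENNReal.ofReal_mul (by positivity), mul_pow, mul_pow]
  congr 1
  rw [show (1 - v.2 / (1 - v.1)) ^ n = (1 - v.2 / (1 - v.1)) ^ m *
    (1 - v.2 / (1 - v.1)) ^ (n - m) by rw [← pow_add, Nat.add_sub_cancel' hmn]]
  ring

/-! ### The recursion for the probabilities -/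

theorem ae_raySide_ne_zero (n : ℕ) :
    ∀ᵐ x ∂pointsLaw n, ∀ i j, i ≠ j → raySide (x i) (x j) ≠ 0 := by
  rcases n with _ | n
  · exact Filter.Eventually.of_forall fun x i => i.elim0
  rw [ae_all_iff]
  intro i
  rw [ae_all_iff]
  intro l
  rcases eq_or_ne l i with rfl | hl
  · simp
  obtain ⟨j, rfl⟩ := Fin.exists_succAbove_eq hl
  have h := measurePreserving_piFinSuccAbove (α := fun _ : Fin (n + 1) => ℝ × ℝ)
    (fun _ => uniformTriangle) i
  have hs : MeasurableSet {q : (ℝ × ℝ) × (Fin n → ℝ × ℝ) | raySide q.1 (q.2 j) = 0} := by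
    refine measurableSet_eq_fun ?_ measurable_const
    unfold raySide
    fun_prop
  have h0 : (uniformTriangle.prod (Measure.pi fun _ : Fin n => uniformTriangle))
      {q : (ℝ × ℝ) × (Fin n → ℝ × ℝ) | raySide q.1 (q.2 j) = 0} = 0 := by
    rw [Measure.measure_prod_null hs]
    filter_upwards [ae_mem_openTriangle] with v hv
    have hm : MeasurableSet {p | raySide v p = 0} :=
      (isClosed_eq (continuous_raySide v) continuous_const).measurableSet
    have := (measurePreserving_eval (fun _ : Fin n => uniformTriangle) j).measure_preimage
      hm.nullMeasurableSet
    rw [uniformTriangle_raySide_eq_zero hv] at this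
    exact this
  rw [← h.measure_preimage hs.nullMeasurableSet] at h0
  have : ∀ᵐ x ∂pointsLaw (n + 1), raySide (x i) (x (i.succAbove j)) ≠ 0 := by
    rw [ae_iff]
    simpa [pointsLaw, Fin.removeNth] using h0
  filter_upwards [this] with x hx _ using hx

/-- The event that the chain starts with an edge from `(1, 0)` to the point with index `i`. -/
def firstEvent {n : ℕ} (i : Fin (n + 1)) : Set (Fin (n + 1) → ℝ × ℝ) :=
  {x | ∀ j, 0 < raySide (x i) (x (i.succAbove j))}

theorem measurableSet_firstEvent {n : ℕ} (i : Fin (n + 1)) : MeasurableSet (firstEvent i) := by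
  have : firstEvent i = ⋂ j, {x : Fin (n + 1) → ℝ × ℝ |
      0 < raySide (x i) (x (i.succAbove j))} := by
    ext; simp [firstEvent]
  rw [this]
  refine MeasurableSet.iInter fun j => measurableSet_lt measurable_const ?_
  unfold raySide
  fun_prop

theorem disjoint_firstEvent {n : ℕ} {i l : Fin (n + 1)} (h : i ≠ l) :
    Disjoint (firstEvent i) (firstEvent l) := by
  refine Set.disjoint_left.2 fun x hi hl => ?_
  obtain ⟨j, hj⟩ := Fin.exists_succAbove_eq h.symm
  obtain ⟨j', hj'⟩ := Fin.exists_succAbove_eq h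
  have h1 := hi j
  have h2 := hl j'
  rw [hj] at h1
  rw [hj'] at h2
  simp only [raySide] at h1 h2
  linarith

/-- The first vertex minimizes the slope seen from `(1, 0)`; ties, which would violate the strict
inequality, have probability zero. -/
theorem ae_mem_iUnion_firstEvent (n : ℕ) : ∀ᵐ x ∂pointsLaw (n + 1), ∃ i, x ∈ firstEvent i := by
  filter_upwards [ae_forall_mem_openTriangle (n + 1), ae_raySide_ne_zero (n + 1)] with x hx hne
  obtain ⟨i, hi⟩ := Finite.exists_min fun i => (x i).2 / (1 - (x i).1)
  refine ⟨i, fun j => lt_of_le_of_ne ?_ (hne _ _ (Fin.succAbove_ne i j).symm).symm⟩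
  obtain ⟨h1, h2, h3⟩ := hx i
  obtain ⟨h4, h5, h6⟩ := hx (i.succAbove j)
  have := hi (i.succAbove j)
  rw [div_le_div_iff₀ (by linarith) (by linarith)] at this
  simp only [raySide]
  linarith

theorem pointsLaw_firstEvent_inter {n : ℕ} (i : Fin (n + 1)) (k : ℕ) :
    pointsLaw (n + 1) (firstEvent i ∩ {x | chainCount (1, 0) (0, 1) x = k + 1}) =
      ∑ m ∈ Finset.range (n + 1), n.choose m • (countProb m k *
        ENNReal.ofReal (2 * ((m.factorial : ℝ) * (n - m + 1).factorial /
        ((n + 1) * (n + 2).factorial)))) := by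
  have h := measurePreserving_piFinSuccAbove (α := fun _ : Fin (n + 1) => ℝ × ℝ)
    (fun _ => uniformTriangle) i
  have hm : MeasurableSet (firstEvent i ∩ {x | chainCount (1, 0) (0, 1) x = k + 1}) :=
    (measurableSet_firstEvent i).inter (measurableSet_chainCount_eq _ _ _)
  have hm' := (MeasurableEquiv.piFinSuccAbove (fun _ => ℝ × ℝ) i).symm.measurable hm
  rw [pointsLaw, ← h.symm.measure_preimage hm.nullMeasurableSet, Measure.prod_apply hm']
  have hv : ∀ᵐ v ∂uniformTriangle, Measure.pi (fun _ : Fin n => uniformTriangle)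
      (Prod.mk v ⁻¹' ((MeasurableEquiv.piFinSuccAbove (fun _ => ℝ × ℝ) i).symm ⁻¹'
        (firstEvent i ∩ {x | chainCount (1, 0) (0, 1) x = k + 1}))) =
      ∑ m ∈ Finset.range (n + 1), n.choose m •
        (ENNReal.ofReal (v.1 * (1 - v.2 / (1 - v.1))) ^ m * countProb m k *
        ENNReal.ofReal ((1 - v.1) * (1 - v.2 / (1 - v.1))) ^ (n - m)) := by
    filter_upwards [ae_mem_openTriangle] with v hv
    rw [← pointsLaw_chainCount_insertNth i hv k, pointsLaw]
    congr 1
    ext y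
    have : (MeasurableEquiv.piFinSuccAbove (fun _ => ℝ × ℝ) i).symm (v, y) =
      i.insertNth v y := rfl
    rw [Set.mem_preimage, Set.mem_preimage, this]
    simp [firstEvent]
  rw [lintegral_congr_ae hv, lintegral_finsetSum _ (fun m _ => by fun_prop)]
  refine Finset.sum_congr rfl fun m hmr => ?_
  rw [← lintegral_uniformTriangle_split (Nat.lt_succ_iff.1 (Finset.mem_range.1 hmr)),
    ← lintegral_const_mul _ (by fun_prop)]
  simp only [nsmul_eq_mul]
  rw [← lintegral_const_mul _ (by fun_prop)]
  congr with v
  ring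

/-- The `n + 1` candidates for the first vertex contribute equally, and $(n+1)\binom{n}{m}$ times
the Beta integral simplifies to the stated weight. -/
theorem countProb_succ_succ (n k : ℕ) :
    countProb (n + 1) (k + 1) = ∑ m ∈ Finset.range (n + 1),
      ENNReal.ofReal (2 * (n + 1 - m) / ((n + 1) * (n + 2))) * countProb m k := by
  have hae : {x : Fin (n + 1) → ℝ × ℝ | chainCount (1, 0) (0, 1) x = k + 1} =ᵐ[pointsLaw (n + 1)]
      ⋃ i, firstEvent i ∩ {x | chainCount (1, 0) (0, 1) x = k + 1} := by
    refine Filter.eventuallyEq_set.2 ?_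
    filter_upwards [ae_mem_iUnion_firstEvent n] with x hx
    simp [hx]
  rw [countProb, measure_congr hae, measure_iUnion
    (fun i l h => (disjoint_firstEvent h).mono Set.inter_subset_left Set.inter_subset_left)
    (fun i => (measurableSet_firstEvent i).inter (measurableSet_chainCount_eq _ _ _)),
    tsum_fintype]
  simp_rw [pointsLaw_firstEvent_inter]
  rw [Finset.sum_const, Finset.card_univ, Fintype.card_fin, Finset.smul_sum]
  refine Finset.sum_congr rfl fun m hm => ?_
  have hmn : m ≤ n := Nat.lt_succ_iff.1 (Finset.mem_range.1 hm)
  rw [nsmul_eq_mul, nsmul_eq_mul, ← ENNReal.ofReal_natCast, ← ENNReal.ofReal_natCast,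
    mul_left_comm (ENNReal.ofReal (n.choose m : ℝ)), mul_left_comm,
    ← ENNReal.ofReal_mul (by positivity), ← ENNReal.ofReal_mul (by positivity), mul_comm]
  congr 2
  rw [Nat.cast_choose ℝ hmn, Nat.factorial_succ (n - m), Nat.factorial_succ (n + 1),
    Nat.factorial_succ n]
  have h1 : ((n - m).factorial : ℝ) ≠ 0 := by positivity
  have h2 : (m.factorial : ℝ) ≠ 0 := by positivity
  have h3 : (n.factorial : ℝ) ≠ 0 := by positivity
  push_cast [Nat.cast_sub hmn]
  have h4 : (n : ℝ) + 1 ≠ 0 := by positivity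
  have h5 : (n : ℝ) + 1 + 1 ≠ 0 := by positivity
  have h6 : (n : ℝ) + 2 ≠ 0 := by positivity
  field_simp
  ring

theorem countProb_succ_zero (n : ℕ) : countProb (n + 1) 0 = 0 := by
  rw [countProb, ← nonpos_iff_eq_zero]
  refine (measure_mono_ae ?_).trans_eq (measure_empty (μ := pointsLaw (n + 1)))
  filter_upwards [ae_mem_iUnion_firstEvent n, ae_forall_mem_openTriangle (n + 1)]
    with x ⟨i, hi⟩ hx h0
  have h0' : chainCount (1, 0) (0, 1) x = 0 := h0
  rw [chainCount_eq_split (hx i) (fun j => hx _) hi (fun j => Iff.rfl)] at h0'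
  exact absurd h0' (Nat.succ_ne_zero _)

theorem countProb_zero_zero : countProb 0 0 = 1 := by
  have : {x : Fin 0 → ℝ × ℝ | chainCount (1, 0) (0, 1) x = 0} = Set.univ := by
    ext x
    simp [chainCount, Set.eq_empty_of_isEmpty]
  rw [countProb, this, measure_univ]

theorem prob_eq (n k : ℕ) : prob n k = (countProb n k).toReal := by
  rw [prob, measureReal_def, countProb]
  congr 1
  refine measure_congr (Filter.eventuallyEq_set.2 ?_)
  filter_upwards [ae_forall_mem_openTriangle n, ae_raySide_ne_zero n] with x hx hne
  have hinj : Function.Injective x := by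
    intro i j hij
    by_contra h
    refine hne i j h ?_
    rw [hij]
    simp [raySide]
  simp [numVertices_eq_chainCount_add_two hx hinj]

theorem prob_zero_zero : prob 0 0 = 1 := by
  rw [prob_eq, countProb_zero_zero, ENNReal.toReal_one]

theorem prob_succ_zero (n : ℕ) : prob (n + 1) 0 = 0 := by
  rw [prob_eq, countProb_succ_zero, ENNReal.toReal_zero]

theorem prob_nonneg (n k : ℕ) : 0 ≤ prob n k := measureReal_nonneg

theorem prob_succ_succ (n k : ℕ) :
    prob (n + 1) (k + 1) = 2 / ((n + 1) * (n + 2)) *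
      ∑ m ∈ Finset.range (n + 1), ((n : ℝ) + 1 - m) * prob m k := by
  rw [prob_eq, countProb_succ_succ, ENNReal.toReal_sum, Finset.mul_sum]
  · refine Finset.sum_congr rfl fun m hm => ?_
    have hmn : (m : ℝ) ≤ n := by exact_mod_cast Nat.lt_succ_iff.1 (Finset.mem_range.1 hm)
    rw [ENNReal.toReal_mul, prob_eq, ENNReal.toReal_ofReal]
    · ring
    · have : 0 ≤ (n : ℝ) + 1 - m := by linarith
      positivity
  · intro m _
    refine ENNReal.mul_ne_top ENNReal.ofReal_ne_top ?_
    exact measure_ne_top _ _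

theorem prob_zero_succ (k : ℕ) : prob 0 (k + 1) = 0 := by
  rw [prob_eq, countProb]
  have : {x : Fin 0 → ℝ × ℝ | chainCount (1, 0) (0, 1) x = k + 1} = ∅ := by
    ext x
    simp [chainCount, Set.eq_empty_of_isEmpty]
  rw [this, measure_empty, ENNReal.toReal_zero]

theorem prob_eq_zero_of_lt {n k : ℕ} (h : n < k) : prob n k = 0 := by
  induction k generalizing n with
  | zero => omega
  | succ k ih =>
    rcases n with _ | n
    · exact prob_zero_succ k
    · rw [prob_succ_succ, Finset.sum_eq_zero, mul_zero]
      intro m hm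
      rw [ih (by have := Finset.mem_range.1 hm; omega), mul_zero]

/-! ### Nearly maximal number of vertices: polynomiality -/

/-- The normalized probability of having `n - k` vertices besides `(1, 0)` and `(0, 1)`. -/
noncomputable def scaledProb (k n : ℕ) : ℝ :=
  prob n (n - k) * ((n.factorial : ℝ) * ((n + 1).factorial : ℝ) / (2 : ℝ) ^ n)

/-- In the recursion only $m = n - j$ with $j \le k$ contributes, since fewer than `n - k` points
cannot give `n - k` vertices. The normalization makes the coefficient at `j = 0` equal to one, so
this is a difference equation with inhomogeneity built from smaller `k`. -/
theorem scaledProb_succ {n k : ℕ} (h : k ≤ n) :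
    scaledProb k (n + 1) = ∑ j ∈ Finset.range (k + 1), ((j : ℝ) + 1) / 2 ^ j *
      (n.descFactorial j * (n + 1).descFactorial j) * scaledProb (k - j) (n - j) := by
  have hsum : ∑ m ∈ Finset.range (n + 1), ((n : ℝ) + 1 - m) * prob m (n - k) =
      ∑ j ∈ Finset.range (k + 1), ((j : ℝ) + 1) * prob (n - j) (n - k) := by
    rw [← Finset.sum_range_reflect, ← Finset.sum_range_add_sum_Ico _ (Nat.succ_le_succ h),
      Finset.sum_eq_zero (s := Finset.Ico _ _), add_zero]
    · refine Finset.sum_congr rfl fun j hj => ?_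
      have hjn : j ≤ n := by have := Finset.mem_range.1 hj; omega
      rw [show n + 1 - 1 - j = n - j by omega]
      push_cast [Nat.cast_sub hjn]
      ring
    · intro j hj
      have := Finset.mem_Ico.1 hj
      rw [prob_eq_zero_of_lt (by omega), mul_zero]
  rw [scaledProb, show n + 1 - k = (n - k) + 1 by omega, prob_succ_succ, hsum, mul_right_comm,
    Finset.mul_sum]
  refine Finset.sum_congr rfl fun j hj => ?_
  have hjk : j ≤ k := Nat.lt_succ_iff.1 (Finset.mem_range.1 hj)
  have hjn : j ≤ n := hjk.trans h
  rw [scaledProb, show n - j - (k - j) = n - k by omega]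
  have h1 : (n.factorial : ℝ) = (n - j).factorial * n.descFactorial j := by
    exact_mod_cast (Nat.factorial_mul_descFactorial hjn).symm
  have h2 : ((n + 1).factorial : ℝ) = (n - j + 1).factorial * (n + 1).descFactorial j := by
    have := Nat.factorial_mul_descFactorial (n := n + 1) (k := j) (by omega)
    rw [show n + 1 - j = n - j + 1 by omega] at this
    exact_mod_cast this.symm
  have h3 : ((n + 1 + 1).factorial : ℝ) = (n + 2) * (n + 1).factorial := by
    rw [Nat.factorial_succ (n + 1)]; push_cast; ring
  have h4 : (((n + 1).factorial : ℕ) : ℝ) = (n + 1) * n.factorial := by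
    rw [Nat.factorial_succ n]; push_cast; ring
  have h5 : (2 : ℝ) ^ (n + 1) = 2 * (2 ^ j * 2 ^ (n - j)) := by
    rw [← pow_add, Nat.add_sub_cancel' hjn]; ring
  have e : ((n + 1).factorial : ℝ) * ((n + 1 + 1).factorial : ℝ) =
      (n + 1) * (n + 2) * (((n - j).factorial * n.descFactorial j) *
        ((n - j + 1).factorial * (n + 1).descFactorial j)) := by
    rw [h3, ← h1, ← h2]
    nth_rewrite 1 [h4]
    ring
  rw [e, h5]
  have h6 : (n : ℝ) + 1 ≠ 0 := by positivity
  have h7 : (n : ℝ) + 2 ≠ 0 := by positivity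
  field_simp

open Polynomial

/-- Induction on the degree bound, removing the top coefficient with a multiple of $X^{d+1}$.
Bounding the degree through coefficients allows the leading ones to vanish. -/
theorem exists_antidifference (d : ℕ) (f : ℝ[X]) (hf : ∀ i, d ≤ i → f.coeff i = 0) :
    ∃ F : ℝ[X], (∀ i, d < i → F.coeff i = 0) ∧ d * F.coeff d = f.coeff (d - 1) ∧
      ∀ x, F.eval (x + 1) - F.eval x = f.eval x := by
  induction d generalizing f with
  | zero =>
    have : f = 0 := by ext i; simpa using hf i (Nat.zero_le i)
    exact ⟨0, by simp, by simp [this], by simp [this]⟩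
  | succ d ih =>
    set a : ℝ := f.coeff d / (d + 1) with ha
    have hd : (d : ℝ) + 1 ≠ 0 := by positivity
    obtain ⟨F, hF1, hF2, hF3⟩ := ih (f - C a * ((X + 1) ^ (d + 1) - X ^ (d + 1))) (by
      intro i hi
      rw [coeff_sub, coeff_C_mul, coeff_sub, coeff_X_add_one_pow, coeff_X_pow]
      rcases hi.eq_or_lt with rfl | hi
      · simp [ha]
        field_simp
        ring
      · rcases (show d + 1 ≤ i from hi).eq_or_lt with rfl | hi
        · simp [hf]
        · rw [hf i hi.le, Nat.choose_eq_zero_of_lt hi, if_neg (by omega)]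
          simp)
    refine ⟨F + C a * X ^ (d + 1), ?_, ?_, ?_⟩
    · intro i hi
      rw [coeff_add, hF1 i (by omega), coeff_C_mul, coeff_X_pow, if_neg (by omega)]
      simp
    · rw [coeff_add, hF1 (d + 1) (by omega), coeff_C_mul, coeff_X_pow, if_pos rfl, ha]
      push_cast
      field_simp
      simp
    · intro x
      have := hF3 x
      simp only [eval_sub, eval_mul, eval_C, eval_pow, eval_add, eval_X, eval_one] at this ⊢
      linarith

theorem coeff_comp_X_add_C {p : ℝ[X]} {d : ℕ} (h : p.natDegree ≤ d) (a : ℝ) :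
    (p.comp (X + C a)).coeff d = p.coeff d := by
  rcases h.eq_or_lt with rfl | h
  · rw [← taylor_apply, coeff_taylor_natDegree]; rfl
  · rw [coeff_eq_zero_of_natDegree_lt h, coeff_eq_zero_of_natDegree_lt]
    rwa [← taylor_apply, natDegree_taylor]

/-- The contribution of index shift `j` to the difference of consecutive normalized
probabilities. -/
noncomputable def shiftTerm (j : ℕ) (p : ℝ[X]) : ℝ[X] :=
  C (((j : ℝ) + 1) / 2 ^ j) * (descPochhammer ℝ j * (descPochhammer ℝ j).comp (X + C 1)) *
    p.comp (X + C (-(j : ℝ)))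

theorem natDegree_shiftTerm_le {j d : ℕ} {p : ℝ[X]} (hp : p.natDegree ≤ d) :
    (shiftTerm j p).natDegree ≤ j + j + d := by
  refine natDegree_mul_le_of_le ((natDegree_C_mul_le _ _).trans
    (natDegree_mul_le_of_le (descPochhammer_natDegree ℝ j).le ?_)) ?_
  · rw [← taylor_apply, natDegree_taylor, descPochhammer_natDegree]
  · rwa [← taylor_apply, natDegree_taylor]

theorem coeff_shiftTerm {j d : ℕ} {p : ℝ[X]} (hp : p.natDegree ≤ d) :
    (shiftTerm j p).coeff (j + j + d) = ((j : ℝ) + 1) / 2 ^ j * p.coeff d := by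
  have h1 : (descPochhammer ℝ j).coeff j = 1 := by
    have := monic_descPochhammer ℝ j
    rwa [Monic, leadingCoeff, descPochhammer_natDegree] at this
  have h2 : ((descPochhammer ℝ j).comp (X + C 1)).natDegree ≤ j := by
    rw [← taylor_apply, natDegree_taylor, descPochhammer_natDegree]
  have h3 : (p.comp (X + C (-(j : ℝ)))).natDegree ≤ d := by
    rwa [← taylor_apply, natDegree_taylor]
  rw [shiftTerm, coeff_mul_add_eq_of_natDegree_le ((natDegree_C_mul_le _ _).trans
    (natDegree_mul_le_of_le (descPochhammer_natDegree ℝ j).le h2)) h3, coeff_C_mul,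
    coeff_mul_add_eq_of_natDegree_le (descPochhammer_natDegree ℝ j).le h2,
    coeff_comp_X_add_C (descPochhammer_natDegree ℝ j).le, coeff_comp_X_add_C hp, h1]
  ring

theorem eval_shiftTerm {j n : ℕ} (h : j ≤ n) (p : ℝ[X]) :
    (shiftTerm j p).eval (n : ℝ) = ((j : ℝ) + 1) / 2 ^ j *
      (n.descFactorial j * (n + 1).descFactorial j) * p.eval ((n - j : ℕ) : ℝ) := by
  have h1 : (descPochhammer ℝ j).eval ((n : ℝ) + 1) = (n + 1).descFactorial j := by
    rw [← descPochhammer_eval_eq_descFactorial]; push_cast; rfl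
  simp only [shiftTerm, eval_mul, eval_C, eval_comp, eval_add, eval_X]
  rw [h1, descPochhammer_eval_eq_descFactorial, Nat.cast_sub h, sub_eq_add_neg]

/-- Shift `j` contributes degree at most $2j + 3(k-j) = 3k - j$, so only $j = 1$, whose weight is
$2/2 = 1$, reaches degree $3k-1$. Summation divides by $3k$, so the leading coefficients satisfy
$c_k = c_{k-1}/(3k)$ with $c_0 = 1$. -/
theorem exists_polynomial_scaledProb (k : ℕ) :
    ∃ P : ℝ[X], P.natDegree ≤ 3 * k ∧ P.coeff (3 * k) = 1 / (3 ^ k * k.factorial) ∧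
      ∀ n, k ≤ n → scaledProb k n = P.eval (n : ℝ) := by
  induction k using Nat.strong_induction_on with
  | _ k ih =>
  choose! P hdeg hlead heval using ih
  rcases k with _ | k
  · refine ⟨1, by simp, by simp, fun n _ => ?_⟩
    induction n with
    | zero => simp [scaledProb, prob_zero_zero]
    | succ n ih =>
      rw [scaledProb_succ (Nat.zero_le n)]
      simpa using ih (Nat.zero_le n)
  · set R : ℝ[X] := ∑ j ∈ Finset.range (k + 1), shiftTerm (j + 1) (P (k - j)) with hR
    have hterm : ∀ j ∈ Finset.range (k + 1),
        (shiftTerm (j + 1) (P (k - j))).natDegree ≤ 3 * k + 2 - j := by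
      intro j hj
      have := Finset.mem_range.1 hj
      refine (natDegree_shiftTerm_le (hdeg (k - j) (by omega))).trans ?_
      omega
    have hR0 : ∀ i, 3 * (k + 1) ≤ i → R.coeff i = 0 := by
      intro i hi
      rw [hR, finsetSum_coeff]
      refine Finset.sum_eq_zero fun j hj => coeff_eq_zero_of_natDegree_lt ?_
      have := hterm j hj
      omega
    have hR1 : R.coeff (3 * (k + 1) - 1) = 1 / (3 ^ k * k.factorial) := by
      rw [hR, finsetSum_coeff, Finset.sum_range_succ', Finset.sum_eq_zero, zero_add,
        show 3 * (k + 1) - 1 = (0 + 1) + (0 + 1) + 3 * (k - 0) by omega,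
        coeff_shiftTerm (hdeg (k - 0) (by omega)), hlead (k - 0) (by omega)]
      · simp
      · intro j hj
        have := Finset.mem_range.1 hj
        have := hterm (j + 1) (Finset.mem_range.2 (by omega))
        exact coeff_eq_zero_of_natDegree_lt (by omega)
    obtain ⟨F, hF1, hF2, hF3⟩ := exists_antidifference (3 * (k + 1)) R hR0
    -- The free constant is fixed by the value at `n = k + 1`, which is zero because a nonempty
    -- sample always contributes a vertex.
    refine ⟨F - C (F.eval ((k + 1 : ℕ) : ℝ)), ?_, ?_, ?_⟩
    · refine natDegree_le_iff_coeff_eq_zero.2 fun i hi => ?_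
      rw [coeff_sub, hF1 i hi, coeff_C, if_neg (by omega), sub_zero]
    · rw [coeff_sub, coeff_C, if_neg (by omega), sub_zero]
      rw [hR1] at hF2
      rw [Nat.factorial_succ]
      push_cast at hF2 ⊢
      have : (k.factorial : ℝ) ≠ 0 := by positivity
      have : (k : ℝ) + 1 ≠ 0 := by positivity
      field_simp at hF2
      rw [eq_div_iff (by positivity)]
      linear_combination hF2
    · intro n hn
      induction n, hn using Nat.le_induction with
      | base => simp [scaledProb, prob_succ_zero]
      | succ n hn ih =>
        have h3 := hF3 n
        rw [scaledProb_succ hn, Finset.sum_range_succ']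
        simp only [Nat.sub_zero, Nat.descFactorial_zero, pow_zero]
        rw [ih]
        have : ∑ j ∈ Finset.range (k + 1), (((j + 1 : ℕ) : ℝ) + 1) / 2 ^ (j + 1) *
            (n.descFactorial (j + 1) * (n + 1).descFactorial (j + 1)) *
            scaledProb (k + 1 - (j + 1)) (n - (j + 1)) = R.eval (n : ℝ) := by
          rw [hR, eval_finsetSum]
          refine Finset.sum_congr rfl fun j hj => ?_
          have := Finset.mem_range.1 hj
          rw [eval_shiftTerm (by omega), Nat.add_sub_add_right,
            heval (k - j) (by omega) _ (by omega)]
        rw [this, ← h3]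
        push_cast
        simp only [eval_sub, eval_C]
        ring

/-! ### Nearly maximal number of vertices: asymptotics -/

theorem isBigO_eval_div_pow_sub {p : ℝ[X]} {d : ℕ} (h : p.natDegree ≤ d) :
    (fun n : ℕ => p.eval (n : ℝ) / (n : ℝ) ^ d - p.coeff d) =O[Filter.atTop]
      fun n : ℕ => 1 / (n : ℝ) := by
  have : (fun n : ℕ => p.eval (n : ℝ) / (n : ℝ) ^ d - p.coeff d) =ᶠ[Filter.atTop]
      fun n : ℕ => ∑ i ∈ Finset.range d, p.coeff i * ((n : ℝ) ^ i / (n : ℝ) ^ d) := by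
    filter_upwards [Filter.eventually_gt_atTop 0] with n hn
    have : (n : ℝ) ≠ 0 := by positivity
    rw [eval_eq_sum_range' (Nat.lt_succ_of_le h), Finset.sum_range_succ, add_div,
      mul_div_cancel_right₀ _ (by positivity), add_sub_cancel_right, Finset.sum_div]
    exact Finset.sum_congr rfl fun i _ => mul_div_assoc _ _ _
  refine this.trans_isBigO (IsBigO.fun_sum fun i hi => IsBigO.const_mul_left ?_ _)
  refine IsBigO.of_bound 1 ?_
  filter_upwards [Filter.eventually_gt_atTop 0] with n hn
  have hn1 : (1 : ℝ) ≤ n := by exact_mod_cast hn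
  have hn0 : (0 : ℝ) < n := by linarith
  have hid := Finset.mem_range.1 hi
  rw [Real.norm_of_nonneg (by positivity), Real.norm_of_nonneg (by positivity), one_mul,
    div_le_div_iff₀ (by positivity) hn0, one_mul, ← pow_succ]
  exact pow_le_pow_right₀ hn1 hid

theorem isBigO_mul_sub_one {f g r : ℕ → ℝ} (hr : r =O[Filter.atTop] fun _ => (1 : ℝ))
    (hf : (fun n => f n - 1) =O[Filter.atTop] r) (hg : (fun n => g n - 1) =O[Filter.atTop] r) :
    (fun n => f n * g n - 1) =O[Filter.atTop] r := by
  have h1 : (fun n => (f n - 1) * (g n - 1)) =O[Filter.atTop] r :=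
    (hf.mul (hg.trans hr)).congr_right fun n => mul_one _
  refine ((h1.add hf).add hg).congr_left fun n => ?_
  ring

theorem isBigO_div_add_one_sub_one :
    (fun n : ℕ => (n : ℝ) / (n + 1) - 1) =O[Filter.atTop] fun n : ℕ => 1 / (n : ℝ) := by
  refine IsBigO.of_bound 1 ?_
  filter_upwards [Filter.eventually_gt_atTop 0] with n hn
  have hn0 : (0 : ℝ) < n := by exact_mod_cast hn
  have : (n : ℝ) / (n + 1) - 1 = -(1 / (n + 1)) := by field_simp; ring
  rw [this, norm_neg, Real.norm_of_nonneg (by positivity), Real.norm_of_nonneg (by positivity),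
    one_mul]
  exact one_div_le_one_div_of_le hn0 (by linarith)

theorem prob_sub_asymptotic (k : ℕ) :
    ∃ δ : ℕ → ℝ, δ =O[Filter.atTop] (fun n : ℕ => 1 / (n : ℝ)) ∧
      ∀ᶠ n : ℕ in Filter.atTop,
        prob n (n - k) =
          (n : ℝ) ^ (3 * (k : ℤ) - 1) / ((3 : ℝ) ^ k * (k.factorial : ℝ)) *
            ((2 : ℝ) ^ n / (n.factorial : ℝ) ^ 2) * (1 + δ n) := by
  obtain ⟨P, hdeg, hlead, heval⟩ := exists_polynomial_scaledProb k
  have hc : (3 : ℝ) ^ k * (k.factorial : ℝ) ≠ 0 := by positivity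
  set c : ℝ := (3 : ℝ) ^ k * (k.factorial : ℝ) with hcdef
  -- `δ` is the exact ratio minus one; the factor `n / (n + 1)` comes from replacing `(n + 1)!` by
  -- `n * n!`.
  refine ⟨fun n => c * (P.eval (n : ℝ) / (n : ℝ) ^ (3 * k)) * (n / (n + 1)) - 1,
    isBigO_mul_sub_one (tendsto_one_div_atTop_nhds_zero_nat.isBigO_one ℝ) ?_
      isBigO_div_add_one_sub_one, ?_⟩
  · refine ((isBigO_eval_div_pow_sub hdeg).const_mul_left c).congr_left fun n => ?_
    rw [hlead, mul_sub, mul_one_div_cancel hc]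
  · filter_upwards [Filter.eventually_gt_atTop 0, Filter.eventually_ge_atTop k] with n hn hkn
    have hn0 : (n : ℝ) ≠ 0 := by positivity
    have h := heval n hkn
    rw [scaledProb, Nat.factorial_succ] at h
    have hz : (n : ℝ) ^ (3 * (k : ℤ) - 1) = (n : ℝ) ^ (3 * k) / n := by
      rw [zpow_sub_one₀ hn0, div_eq_mul_inv]
      congr 1
    rw [hz, add_sub_cancel, ← h]
    have : (n.factorial : ℝ) ≠ 0 := by positivity
    push_cast
    field_simp

/-! ### Few vertices: harmonic sums and the logarithmic asymptotics -/

theorem mul_pow_mul_sub_le {x y : ℝ} (hx : 0 ≤ x) (hxy : x ≤ y) (k : ℕ) :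
    k * x ^ (k - 1) * (y - x) ≤ y ^ k - x ^ k := by
  rw [← geom_sum₂_mul]
  refine mul_le_mul_of_nonneg_right ?_ (sub_nonneg.2 hxy)
  calc (k : ℝ) * x ^ (k - 1) = ∑ i ∈ Finset.range k, x ^ (k - 1) := by simp
    _ ≤ _ := by
      refine Finset.sum_le_sum fun i hi => ?_
      have := Finset.mem_range.1 hi
      rw [show k - 1 = i + (k - 1 - i) by omega, pow_add, Nat.add_sub_cancel_left]
      exact mul_le_mul_of_nonneg_right (pow_le_pow_left₀ hx hxy i) (by positivity)

theorem pow_sub_pow_le {x y : ℝ} (hx : 0 ≤ x) (hxy : x ≤ y) (k : ℕ) :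
    y ^ k - x ^ k ≤ k * y ^ (k - 1) * (y - x) := by
  rw [← geom_sum₂_mul]
  refine mul_le_mul_of_nonneg_right ?_ (sub_nonneg.2 hxy)
  calc _ ≤ ∑ i ∈ Finset.range k, y ^ (k - 1) := by
        refine Finset.sum_le_sum fun i hi => ?_
        have := Finset.mem_range.1 hi
        rw [show y ^ (k - 1) = y ^ i * y ^ (k - 1 - i) by rw [← pow_add]; congr 1; omega]
        exact mul_le_mul_of_nonneg_left (pow_le_pow_left₀ hx hxy _)
          (pow_nonneg (hx.trans hxy) _)
    _ = _ := by simp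

/-- The harmonic numbers as real numbers. -/
noncomputable def realHarmonic (n : ℕ) : ℝ := (harmonic n : ℝ)

theorem realHarmonic_succ (n : ℕ) : realHarmonic (n + 1) = realHarmonic n + 1 / ((n : ℝ) + 1) := by
  simp [realHarmonic, harmonic_succ]

theorem realHarmonic_mono : Monotone realHarmonic := by
  refine monotone_nat_of_le_succ fun n => ?_
  rw [realHarmonic_succ]
  have : 0 ≤ 1 / ((n : ℝ) + 1) := by positivity
  linarith

theorem realHarmonic_nonneg (n : ℕ) : 0 ≤ realHarmonic n := by
  have := realHarmonic_mono (Nat.zero_le n)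
  simpa [realHarmonic] using this

/-- A discrete form of $\int k H^{k-1}\,dH = H^k$: consecutive harmonic numbers differ by $1/(m+1)$,
and the bounds on differences of powers telescope. -/
theorem mul_sum_realHarmonic_pow_le (k n : ℕ) :
    k * ∑ m ∈ Finset.range n, realHarmonic m ^ (k - 1) / ((m : ℝ) + 1) ≤ realHarmonic n ^ k := by
  induction n with
  | zero => simpa using pow_nonneg (realHarmonic_nonneg 0) k
  | succ n ih =>
    have h := mul_pow_mul_sub_le (realHarmonic_nonneg n) (realHarmonic_mono n.le_succ) k
    rw [Finset.sum_range_succ, mul_add]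
    have h2 : realHarmonic (n + 1) - realHarmonic n = 1 / ((n : ℝ) + 1) := by
      rw [realHarmonic_succ]; ring
    rw [Nat.succ_eq_add_one, h2] at h
    have h3 : (k : ℝ) * (realHarmonic n ^ (k - 1) / ((n : ℝ) + 1)) =
      k * realHarmonic n ^ (k - 1) * (1 / ((n : ℝ) + 1)) := by ring
    rw [h3]
    linarith

theorem le_sum_realHarmonic_pow (k n : ℕ) :
    realHarmonic n ^ (k + 1) / (k + 1) - 2 * realHarmonic n ^ k ≤
      ∑ m ∈ Finset.range n, realHarmonic m ^ k / ((m : ℝ) + 2) := by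
  -- Two corrections, each summing to at most $H_n^k$, account for the constant 2: replacing
  -- $H_{m+1}^k$ by $H_m^k$, and $1/(m+1)$ by $1/(m+2)$.
  have key : ∀ m : ℕ, (realHarmonic (m + 1) ^ (k + 1) - realHarmonic m ^ (k + 1)) / (k + 1) -
      (realHarmonic (m + 1) ^ k - realHarmonic m ^ k) -
      realHarmonic m ^ k * (1 / ((m : ℝ) + 1) - 1 / (m + 2)) ≤
      realHarmonic m ^ k / ((m : ℝ) + 2) := by
    intro m
    have h := pow_sub_pow_le (realHarmonic_nonneg m) (realHarmonic_mono m.le_succ) (k + 1)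
    have h2 : realHarmonic (m + 1) - realHarmonic m = 1 / ((m : ℝ) + 1) := by
      rw [realHarmonic_succ]; ring
    rw [Nat.succ_eq_add_one, h2, Nat.add_sub_cancel] at h
    push_cast at h
    have h3 : (realHarmonic (m + 1) ^ (k + 1) - realHarmonic m ^ (k + 1)) / (k + 1) ≤
        realHarmonic (m + 1) ^ k * (1 / ((m : ℝ) + 1)) := by
      rw [div_le_iff₀ (by positivity)]
      linarith
    have h4 : (realHarmonic (m + 1) ^ k - realHarmonic m ^ k) * (1 / ((m : ℝ) + 1)) ≤
        (realHarmonic (m + 1) ^ k - realHarmonic m ^ k) := by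
      refine mul_le_of_le_one_right (sub_nonneg.2 (pow_le_pow_left₀ (realHarmonic_nonneg m)
        (realHarmonic_mono m.le_succ) k)) ?_
      rw [div_le_one (by positivity)]
      have : (0 : ℝ) ≤ m := by positivity
      linarith
    have h5 : realHarmonic m ^ k / ((m : ℝ) + 2) = realHarmonic m ^ k * (1 / ((m : ℝ) + 2)) := by
      ring
    rw [h5]
    linarith
  have hsum := Finset.sum_le_sum fun m (_ : m ∈ Finset.range n) => key m
  rw [Finset.sum_sub_distrib, Finset.sum_sub_distrib, ← Finset.sum_div,
    Finset.sum_range_sub (fun m => realHarmonic m ^ (k + 1)),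
    Finset.sum_range_sub (fun m => realHarmonic m ^ k)] at hsum
  have h0 : realHarmonic 0 = 0 := by simp [realHarmonic]
  have h6 : ∑ m ∈ Finset.range n, realHarmonic m ^ k * (1 / ((m : ℝ) + 1) - 1 / (m + 2)) ≤
      realHarmonic n ^ k := by
    calc _ ≤ ∑ m ∈ Finset.range n, realHarmonic n ^ k * (1 / ((m : ℝ) + 1) - 1 / (m + 2)) := by
          refine Finset.sum_le_sum fun m hm => mul_le_mul_of_nonneg_right
            (pow_le_pow_left₀ (realHarmonic_nonneg m)
              (realHarmonic_mono (Finset.mem_range.1 hm).le) k) ?_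
          exact sub_nonneg.2 (one_div_le_one_div_of_le (by positivity) (by linarith))
      _ = realHarmonic n ^ k * (1 - 1 / (n + 1)) := by
          rw [← Finset.mul_sum]
          congr 1
          have := Finset.sum_range_sub' (fun m : ℕ => 1 / ((m : ℝ) + 1)) n
          simp only [Nat.cast_zero, zero_add, div_one] at this
          rw [← this]
          refine Finset.sum_congr rfl fun m _ => ?_
          push_cast
          ring
      _ ≤ _ := by
          refine mul_le_of_le_one_right (pow_nonneg (realHarmonic_nonneg n) k) ?_
          have : 0 ≤ 1 / ((n : ℝ) + 1) := by positivity
          linarith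
  -- For `k = 0` this power is $0^0 = 1$, so only its sign is used.
  have h7 : 0 ≤ realHarmonic 0 ^ k := pow_nonneg (realHarmonic_nonneg 0) k
  have h8 : realHarmonic 0 ^ (k + 1) = 0 := by rw [h0]; simp
  rw [h8, sub_zero] at hsum
  linarith

/-- The probability of having `k + 1` vertices besides `(1, 0)` and `(0, 1)` among `n + 1` points,
multiplied by `n + 2`. -/
noncomputable def weightedProb (k n : ℕ) : ℝ := (n + 2) * prob (n + 1) (k + 1)

theorem weightedProb_nonneg (k n : ℕ) : 0 ≤ weightedProb k n := by
  have := prob_nonneg (n + 1) (k + 1)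
  unfold weightedProb
  positivity

theorem weightedProb_zero (n : ℕ) : weightedProb 0 n = 2 := by
  rw [weightedProb, prob_succ_succ, Finset.sum_range_succ', Finset.sum_eq_zero]
  · have : (n : ℝ) + 1 ≠ 0 := by positivity
    have : (n : ℝ) + 2 ≠ 0 := by positivity
    simp [prob_zero_zero]
    field_simp
  · intro m _
    rw [prob_succ_zero, mul_zero]

/-- The weight $(n-m)/(n+1)$ splits as $1 - (m+1)/(n+1)$. The first part gives the main harmonic
sum; the second is an average, one power of the logarithm smaller. -/
theorem weightedProb_succ (k n : ℕ) :
    weightedProb (k + 1) n = 2 * ∑ m ∈ Finset.range n, weightedProb k m / ((m : ℝ) + 2) -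
      2 / (n + 1) * ∑ m ∈ Finset.range n, ((m : ℝ) + 1) / (m + 2) * weightedProb k m := by
  have hn : (n : ℝ) + 1 ≠ 0 := by positivity
  have hn2 : (n : ℝ) + 2 ≠ 0 := by positivity
  rw [weightedProb, prob_succ_succ, Finset.sum_range_succ', prob_zero_succ, mul_zero, add_zero,
    Finset.mul_sum, Finset.mul_sum, Finset.mul_sum, Finset.mul_sum, ← Finset.sum_sub_distrib]
  refine Finset.sum_congr rfl fun m _ => ?_
  have hm : (m : ℝ) + 2 ≠ 0 := by positivity
  unfold weightedProb
  push_cast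
  field_simp

theorem weightedProb_le (k n : ℕ) :
    weightedProb k n ≤ 2 ^ (k + 1) / k.factorial * realHarmonic n ^ k := by
  induction k generalizing n with
  | zero => simp [weightedProb_zero]
  | succ k ih =>
    have h1 : 0 ≤ 2 / ((n : ℝ) + 1) *
        ∑ m ∈ Finset.range n, ((m : ℝ) + 1) / (m + 2) * weightedProb k m := by
      refine mul_nonneg (by positivity) (Finset.sum_nonneg fun m _ => ?_)
      have := weightedProb_nonneg k m
      positivity
    have h2 : ∑ m ∈ Finset.range n, weightedProb k m / ((m : ℝ) + 2) ≤
        2 ^ (k + 1) / k.factorial *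
          ∑ m ∈ Finset.range n, realHarmonic m ^ k / ((m : ℝ) + 1) := by
      rw [Finset.mul_sum]
      refine Finset.sum_le_sum fun m _ => ?_
      rw [← mul_div_assoc]
      exact div_le_div₀ ((weightedProb_nonneg k m).trans (ih m)) (ih m) (by positivity)
        (by linarith)
    have h3 := mul_sum_realHarmonic_pow_le (k + 1) n
    rw [Nat.add_sub_cancel] at h3
    set S := ∑ m ∈ Finset.range n, realHarmonic m ^ k / ((m : ℝ) + 1)
    have h4 : S ≤ realHarmonic n ^ (k + 1) / (k + 1) := by
      rw [le_div_iff₀ (by positivity)]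
      push_cast at h3
      linarith
    rw [weightedProb_succ]
    calc _ ≤ 2 * (2 ^ (k + 1) / k.factorial * S) := by linarith
      _ ≤ 2 * (2 ^ (k + 1) / k.factorial * (realHarmonic n ^ (k + 1) / (k + 1))) := by gcongr
      _ = _ := by
        rw [Nat.factorial_succ]
        push_cast
        field_simp
        ring

/-- The factor `k` in the error term makes it vanish at `k = 0`, where `weightedProb` is constant
and the truncated exponent `k - 1` would be misleading. -/
theorem exists_le_weightedProb (k : ℕ) : ∃ c : ℝ, 0 ≤ c ∧ ∀ n,
    2 ^ (k + 1) / k.factorial * realHarmonic n ^ k - c * (k * realHarmonic n ^ (k - 1)) ≤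
      weightedProb k n := by
  induction k with
  | zero => exact ⟨0, le_rfl, fun n => by simp [weightedProb_zero]⟩
  | succ k ih =>
    obtain ⟨c, hc, h⟩ := ih
    set A : ℝ := 2 ^ (k + 1) / k.factorial with hA
    have hA0 : 0 ≤ A := by positivity
    -- The doubled main sum costs `4 * A` by `le_sum_realHarmonic_pow` and `2 * c` from the
    -- inductive error; the averaged term costs `2 * A`.
    refine ⟨6 * A + 2 * c, by positivity, fun n => ?_⟩
    have hH : 0 ≤ realHarmonic n ^ k := pow_nonneg (realHarmonic_nonneg n) k
    have h1 : 2 / ((n : ℝ) + 1) *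
        ∑ m ∈ Finset.range n, ((m : ℝ) + 1) / (m + 2) * weightedProb k m ≤
        2 * (A * realHarmonic n ^ k) := by
      have : ∑ m ∈ Finset.range n, ((m : ℝ) + 1) / (m + 2) * weightedProb k m ≤
          ∑ m ∈ Finset.range n, A * realHarmonic n ^ k := by
        refine Finset.sum_le_sum fun m hm => ?_
        refine (mul_le_of_le_one_left (weightedProb_nonneg k m) ?_).trans
          ((weightedProb_le k m).trans ?_)
        · rw [div_le_one (by positivity)]; linarith
        · exact mul_le_mul_of_nonneg_left (pow_le_pow_left₀ (realHarmonic_nonneg m)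
            (realHarmonic_mono (Finset.mem_range.1 hm).le) k) hA0
      rw [Finset.sum_const, Finset.card_range, nsmul_eq_mul] at this
      calc _ ≤ 2 / ((n : ℝ) + 1) * (n * (A * realHarmonic n ^ k)) := by gcongr
        _ = n / (n + 1) * (2 * (A * realHarmonic n ^ k)) := by ring
        _ ≤ _ := mul_le_of_le_one_left (by positivity)
          (by rw [div_le_one (by positivity)]; linarith)
    have h2 : A * (realHarmonic n ^ (k + 1) / (k + 1) - 2 * realHarmonic n ^ k) -
        c * realHarmonic n ^ k ≤ ∑ m ∈ Finset.range n, weightedProb k m / ((m : ℝ) + 2) := by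
      have e1 : ∑ m ∈ Finset.range n, (A * (realHarmonic m ^ k / ((m : ℝ) + 2)) -
          c * (k * (realHarmonic m ^ (k - 1) / ((m : ℝ) + 1)))) ≤
          ∑ m ∈ Finset.range n, weightedProb k m / ((m : ℝ) + 2) := by
        refine Finset.sum_le_sum fun m _ => ?_
        have e2 : (A * realHarmonic m ^ k - c * (k * realHarmonic m ^ (k - 1))) / ((m : ℝ) + 2) ≤
            weightedProb k m / ((m : ℝ) + 2) := by
          gcongr
          exact h m
        refine le_trans ?_ e2
        have e3 : 0 ≤ realHarmonic m ^ (k - 1) := pow_nonneg (realHarmonic_nonneg m) _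
        have e4 : realHarmonic m ^ (k - 1) / ((m : ℝ) + 2) ≤
            realHarmonic m ^ (k - 1) / ((m : ℝ) + 1) :=
          div_le_div_of_nonneg_left e3 (by positivity) (by linarith)
        have e5 : c * (k * (realHarmonic m ^ (k - 1) / ((m : ℝ) + 2))) ≤
            c * (k * (realHarmonic m ^ (k - 1) / ((m : ℝ) + 1))) := by gcongr
        have e6 : (A * realHarmonic m ^ k - c * (k * realHarmonic m ^ (k - 1))) / ((m : ℝ) + 2) =
            A * (realHarmonic m ^ k / ((m : ℝ) + 2)) -
              c * (k * (realHarmonic m ^ (k - 1) / ((m : ℝ) + 2))) := by ring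
        rw [e6]
        linarith
      rw [Finset.sum_sub_distrib, ← Finset.mul_sum, ← Finset.mul_sum, ← Finset.mul_sum] at e1
      have e7 := mul_le_mul_of_nonneg_left (le_sum_realHarmonic_pow k n) hA0
      have e8 := mul_le_mul_of_nonneg_left (mul_sum_realHarmonic_pow_le k n) hc
      linarith
    rw [weightedProb_succ, Nat.add_sub_cancel]
    have h3 : (2 : ℝ) ^ (k + 1 + 1) / (k + 1).factorial * realHarmonic n ^ (k + 1) =
        2 * (A * (realHarmonic n ^ (k + 1) / (k + 1))) := by
      rw [hA, Nat.factorial_succ]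
      push_cast
      field_simp
      ring
    rw [h3]
    have h4 : (6 * A + 2 * c) * realHarmonic n ^ k ≤
        (6 * A + 2 * c) * (((k + 1 : ℕ) : ℝ) * realHarmonic n ^ k) := by
      refine mul_le_mul_of_nonneg_left (le_mul_of_one_le_left hH ?_) (by positivity)
      push_cast
      have : (0 : ℝ) ≤ k := by positivity
      linarith
    linarith

theorem prob_succ_asymptotic (k : ℕ) :
    ∃ ε : ℕ → ℝ, ε =O[Filter.atTop] (fun n : ℕ => 1 / Real.log (n : ℝ)) ∧
      ∀ᶠ n : ℕ in Filter.atTop,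
        prob n (k + 1) =
          (2 : ℝ) ^ (k + 1) / (k.factorial : ℝ) * (Real.log (n : ℝ) ^ k / (n : ℝ)) *
            (1 + ε n) := by
  obtain ⟨c, hc, hlow⟩ := exists_le_weightedProb k
  set A : ℝ := 2 ^ (k + 1) / k.factorial with hA
  have hA0 : 0 < A := by positivity
  have hlog : Filter.Tendsto (fun n : ℕ => Real.log (n : ℝ)) Filter.atTop Filter.atTop :=
    Real.tendsto_log_atTop.comp tendsto_natCast_atTop_atTop
  have hlog1 : (fun n : ℕ => 1 / Real.log (n : ℝ)) =O[Filter.atTop] fun _ => (1 : ℝ) := by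
    have : Filter.Tendsto (fun n : ℕ => 1 / Real.log (n : ℝ)) Filter.atTop (nhds 0) := by
      simp_rw [one_div]
      exact hlog.inv_tendsto_atTop
    exact this.isBigO_one ℝ
  -- `ε` is again the exact ratio minus one: `weightedProb k (n - 1)` is `(n + 1) * prob n (k + 1)`
  -- for positive `n`.
  refine ⟨fun n => n / (n + 1) * (weightedProb k (n - 1) / (A * Real.log n ^ k)) - 1,
    isBigO_mul_sub_one hlog1 (isBigO_div_add_one_sub_one.trans ?_) ?_, ?_⟩
  · refine IsBigO.of_bound 1 ?_
    filter_upwards [hlog.eventually_ge_atTop 1, Filter.eventually_gt_atTop 0] with n hn hn0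
    have hn0' : (0 : ℝ) < n := by exact_mod_cast hn0
    rw [Real.norm_of_nonneg (by positivity), Real.norm_of_nonneg (by positivity), one_mul]
    refine one_div_le_one_div_of_le (by linarith) ?_
    have := Real.log_le_sub_one_of_pos hn0'
    linarith
  · refine IsBigO.of_bound ((c + A) * (k * 2 ^ (k - 1)) / A) ?_
    filter_upwards [hlog.eventually_ge_atTop 1, Filter.eventually_gt_atTop 1] with n hn hn1
    obtain ⟨n, rfl⟩ : ∃ m, n = m + 1 := ⟨n - 1, by omega⟩
    rw [Nat.add_sub_cancel]
    set L := Real.log ((n + 1 : ℕ) : ℝ) with hL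
    have hL0 : 0 < L := by linarith
    have hLH : L ≤ realHarmonic n := log_add_one_le_harmonic n
    have hHL : realHarmonic n ≤ L + 1 := by
      have h1 := harmonic_le_one_add_log n
      have h2 : Real.log n ≤ L :=
        Real.log_le_log (by exact_mod_cast (by omega : 0 < n)) (by push_cast; linarith)
      unfold realHarmonic
      linarith
    have hup := weightedProb_le k n
    have hlo := hlow n
    have hpow := pow_sub_pow_le hL0.le hLH k
    have hpow0 : L ^ k ≤ realHarmonic n ^ k := pow_le_pow_left₀ hL0.le hLH k
    -- Once `L` is at least 1, the harmonic number is at most `L + 1`, hence at most `2 * L`.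
    have hH1 : realHarmonic n ^ (k - 1) ≤ 2 ^ (k - 1) * L ^ (k - 1) := by
      rw [← mul_pow]
      exact pow_le_pow_left₀ (realHarmonic_nonneg n) (by linarith) _
    have hH0 : 0 ≤ realHarmonic n ^ (k - 1) := pow_nonneg (realHarmonic_nonneg n) _
    have hdiff : realHarmonic n ^ k - L ^ k ≤ k * realHarmonic n ^ (k - 1) :=
      hpow.trans (mul_le_of_le_one_right (by positivity) (by linarith))
    have habs : |weightedProb k n - A * L ^ k| ≤
        (c + A) * (k * (2 ^ (k - 1) * L ^ (k - 1))) := by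
      have g1 : (c + A) * (k * realHarmonic n ^ (k - 1)) ≤
          (c + A) * (k * (2 ^ (k - 1) * L ^ (k - 1))) := by gcongr
      have g2 := mul_le_mul_of_nonneg_left hdiff hA0.le
      have g3 := mul_le_mul_of_nonneg_left hpow0 hA0.le
      have g4 : 0 ≤ c * (k * realHarmonic n ^ (k - 1)) := by positivity
      have g5 : 0 ≤ A * (k * realHarmonic n ^ (k - 1)) := by positivity
      rw [abs_le]
      constructor <;> linarith
    have hAL : 0 < A * L ^ k := by positivity
    have e : weightedProb k n / (A * L ^ k) - 1 = (weightedProb k n - A * L ^ k) / (A * L ^ k) := by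
      rw [sub_div, div_self hAL.ne']
    rw [e, Real.norm_eq_abs, abs_div, abs_of_pos hAL, Real.norm_of_nonneg (by positivity),
      div_le_iff₀ hAL]
    refine habs.trans_eq ?_
    rcases k with _ | k
    · simp
    · rw [Nat.add_sub_cancel]
      field_simp
      ring
  · filter_upwards [hlog.eventually_ge_atTop 1, Filter.eventually_gt_atTop 0] with n hn hn0
    obtain ⟨n, rfl⟩ : ∃ m, n = m + 1 := ⟨n - 1, by omega⟩
    have hL0 : Real.log ((n + 1 : ℕ) : ℝ) ≠ 0 := by linarith
    have hn1 : (n : ℝ) + 1 ≠ 0 := by positivity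
    have hn2 : (n : ℝ) + 2 ≠ 0 := by positivity
    rw [add_sub_cancel, Nat.add_sub_cancel, weightedProb]
    set L := Real.log ((n + 1 : ℕ) : ℝ)
    push_cast
    rw [show (n : ℝ) + 1 + 1 = n + 2 by ring]
    field_simp

end RandomConvexChain

theorem theorem8 (k : ℕ) :
    (∃ ε : ℕ → ℝ, ε =O[Filter.atTop] (fun n : ℕ => 1 / Real.log (n : ℝ)) ∧
      ∀ᶠ n : ℕ in Filter.atTop,
        RandomConvexChain.prob n (k + 1) =
          (2 : ℝ) ^ (k + 1) / (k.factorial : ℝ) * (Real.log (n : ℝ) ^ k / (n : ℝ)) * (1 + ε n)) ∧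
    (∃ δ : ℕ → ℝ, δ =O[Filter.atTop] (fun n : ℕ => 1 / (n : ℝ)) ∧
      ∀ᶠ n : ℕ in Filter.atTop,
        RandomConvexChain.prob n (n - k) =
          (n : ℝ) ^ (3 * (k : ℤ) - 1) / ((3 : ℝ) ^ k * (k.factorial : ℝ)) *
            ((2 : ℝ) ^ n / (n.factorial : ℝ) ^ 2) * (1 + δ n)) ∧
    (∃ C : Polynomial ℝ, C.degree = ((3 * k : ℕ) : WithBot ℕ) ∧
      ∀ n : ℕ, k ≤ n →
        RandomConvexChain.prob n (n - k) *
          ((n.factorial : ℝ) * ((n + 1).factorial : ℝ) / (2 : ℝ) ^ n) = C.eval (n : ℝ)) := by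
  refine ⟨RandomConvexChain.prob_succ_asymptotic k, RandomConvexChain.prob_sub_asymptotic k, ?_⟩
  obtain ⟨P, hdeg, hlead, heval⟩ := RandomConvexChain.exists_polynomial_scaledProb k
  refine ⟨P, Polynomial.degree_eq_of_le_of_coeff_ne_zero
    (Polynomial.natDegree_le_iff_degree_le.1 hdeg) ?_, heval⟩
  rw [hlead]
  positivity
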